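/- Let $a\neq 0$ be real, let $I\subseteq\mathbb R$ be open and let $\mathcal M:I\to\mathbb R$ be of class $C^3$. Put $\Sigma=r^2+a^2\cos^2\theta$, $\Delta_r=r^2-2\mathcal M(r)r+a^2$, $\varrho=r+ia\cos\theta$, $\bar\varrho=r-ia\cos\theta$, and consider the Kerr-like metric $$ds^2=-\frac{\Delta_r}{\Sigma}(dt-a\sin^2\theta\,d\phi)^2+\frac{\Sigma}{\Delta_r}dr^2+\Sigma\,d\theta^2+\frac{\sin^2\theta}{\Sigma}\bigl(a\,dt-(r^2+a^2)\,d\phi\bigr)^2$$ on the chart domain $U=\{(t,r,\theta,\phi): r\in I,\ 0<\theta<\pi,\ \Sigma\neq0,\ \Delta_r\neq0\}$, with the vectors $$\mathbf l=\tfrac1{\Delta_r}\bigl((r^2+a^2)\partial_t+\Delta_r\partial_r+a\,\partial_\phi\bigr),\quad \mathbf k=\tfrac1{2\Sigma}\bigl((r^2+a^2)\partial_t-\Delta_r\partial_r+a\,\partial_\phi\bigr),\quad \mathbf m=\tfrac1{\sqrt2\,\varrho}\bigl(ia\sin\theta\,\partial_t+\partial_\theta+i\csc\theta\,\partial_\phi\bigr).$$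 Let $C_{\kappa\lambda\mu\nu}$ be the Weyl tensor (with $R^a{}_{bcd}=\partial_c\Gamma^a_{bd}-\partial_d\Gamma^a_{bc}+\Gamma^a_{ce}\Gamma^e_{bd}-\Gamma^a_{de}\Gamma^e_{bc}$) and $$\Psi_0=C(\mathbf l,\mathbf m,\mathbf l,\mathbf m),\ \Psi_1=C(\mathbf l,\mathbf k,\mathbf l,\mathbf m),\ \Psi_2=C(\mathbf l,\mathbf m,\bar{\mathbf m},\mathbf k),\ \Psi_3=C(\mathbf k,\mathbf l,\mathbf k,\bar{\mathbf m}),\ \Psi_4=C(\mathbf k,\bar{\mathbf m},\mathbf k,\bar{\mathbf m}).$$ A nonzero real null vector $n$ spans a principal null direction (PND) of $C$ if $n_{[e}C_{a]bc[d}n_{f]}n^bn^c=0$; the PND is double if $C_{abc[d}n_{e]}n^bn^c=0$ but not $C_{abc[d}n_{e]}n^c=0$. The Weyl tensor is of Petrov type D at a point if it has there exactly two PNDs, both double. Then: 1. At every point of $U$, $(\mathbf l,\mathbf k,\mathbf m,\bar{\mathbf m})$ is a null tetrad with $\mathbf l\cdot\mathbf k=-1$, $\mathbf m\cdot\bar{\mathbf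 m}=1$ and all other products zero; $\Psi_0=\Psi_1=\Psi_3=\Psi_4=0$; and $$\Psi_2=-\frac{6\varrho\,\mathcal M-2(r+\varrho)\bar\varrho\,\mathcal M'+r\bar\varrho^2\mathcal M''}{6\varrho\bar\varrho^3}.$$ 2. A point of $U$ is of Petrov type D if and only if $\Psi_2\neq0$ there, and in that case the two double principal null directions are those of $\mathbf l$ and $\mathbf k$, and there is no other principal null direction. 3. The set of points of $U$ with $\Psi_2\ne0$ is open, and its closure contains every point of $U$ with $\mathcal M(r)\neq0$. -/

import Mathlib

noncomputable section

namespace KerrLike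

/-! ### Curvature of a metric in a coordinate chart of a four-dimensional spacetime -/

/-- Points of the chart, and also coordinate components of real tangent vectors. -/
abbrev Pt : Type := Fin 4 → ℝ

/-- Components `T a b c d` of a covariant 4-tensor at a point. -/
abbrev Tensor4 : Type := Fin 4 → Fin 4 → Fin 4 → Fin 4 → ℝ

/-- The partial derivative `∂f/∂xⁱ` at `x`. -/
def pd (i : Fin 4) (f : Pt → ℝ) (x : Pt) : ℝ :=
  deriv (fun s : ℝ => f (Function.update x i s)) (x i)

/-- Christoffel symbols `Γᵃ_{bc}` of the Levi-Civita connection of the metric `g`. -/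
def christoffel (g : Pt → Matrix (Fin 4) (Fin 4) ℝ) (a b c : Fin 4) (x : Pt) : ℝ :=
  (1 / 2) * ∑ d, (g x)⁻¹ a d *
    (pd b (fun y => g y d c) x + pd c (fun y => g y d b) x - pd d (fun y => g y b c) x)

/-- Riemann tensor `Rᵃ_{bcd} = ∂_c Γᵃ_{bd} - ∂_d Γᵃ_{bc} + Γᵃ_{ce} Γᵉ_{bd} - Γᵃ_{de} Γᵉ_{bc}`. -/
def riemannUp (g : Pt → Matrix (Fin 4) (Fin 4) ℝ) (x : Pt) (a b c d : Fin 4) : ℝ :=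
  pd c (christoffel g a b d) x - pd d (christoffel g a b c) x
    + ∑ e, (christoffel g a c e x * christoffel g e b d x
      - christoffel g a d e x * christoffel g e b c x)

/-- Riemann tensor `R_{abcd}` with all indices lowered. -/
def riemann (g : Pt → Matrix (Fin 4) (Fin 4) ℝ) (x : Pt) : Tensor4 :=
  fun a b c d => ∑ e, g x a e * riemannUp g x e b c d

/-- Ricci tensor `R_{bd} = Rᵃ_{bad}`. -/
def ricci (g : Pt → Matrix (Fin 4) (Fin 4) ℝ) (x : Pt) (b d : Fin 4) : ℝ :=
  ∑ a, riemannUp g x a b a d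

/-- Curvature scalar. -/
def scalarCurv (g : Pt → Matrix (Fin 4) (Fin 4) ℝ) (x : Pt) : ℝ :=
  ∑ b, ∑ d, (g x)⁻¹ b d * ricci g x b d

/-- Weyl tensor `C_{abcd}` (dimension four). -/
def weyl (g : Pt → Matrix (Fin 4) (Fin 4) ℝ) (x : Pt) : Tensor4 :=
  fun a b c d =>
    riemann g x a b c d
      - (1 / 2) * (g x a c * ricci g x b d - g x a d * ricci g x b c
          - g x b c * ricci g x a d + g x b d * ricci g x a c)
      + scalarCurv g x / 6 * (g x a c * g x b d - g x a d * g x b c)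

/-! ### Principal null directions and Petrov type D, at a point -/

/-- Lowering an index: `n_a = g_{ab} nᵇ`. -/
def lower (g : Matrix (Fin 4) (Fin 4) ℝ) (n : Pt) (a : Fin 4) : ℝ := ∑ b, g a b * n b

/-- `n` is a nonzero real null vector. -/
def IsNullVec (g : Matrix (Fin 4) (Fin 4) ℝ) (n : Pt) : Prop :=
  n ≠ 0 ∧ ∑ a, ∑ b, g a b * n a * n b = 0

/-- `C_{abcd} nᵇ nᶜ`. -/
def contr2 (C : Tensor4) (n : Pt) (a d : Fin 4) : ℝ := ∑ b, ∑ c, C a b c d * n b * n c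

/-- `C_{abcd} nᶜ`. -/
def contr1 (C : Tensor4) (n : Pt) (a b d : Fin 4) : ℝ := ∑ c, C a b c d * n c

/-- The null vector `n` spans a principal null direction of `C` (of any multiplicity):
`n_{[e} C_{a]bc[d} n_{f]} nᵇ nᶜ = 0`. -/
def IsPND (g : Matrix (Fin 4) (Fin 4) ℝ) (C : Tensor4) (n : Pt) : Prop :=
  IsNullVec g n ∧ ∀ e a d f,
    lower g n e * contr2 C n a d * lower g n f - lower g n a * contr2 C n e d * lower g n f
      - lower g n e * contr2 C n a f * lower g n d
      + lower g n a * contr2 C n e f * lower g n d = 0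

/-- Multiplicity at least two: `C_{abc[d} n_{e]} nᵇ nᶜ = 0`. -/
def IsPNDGeTwo (g : Matrix (Fin 4) (Fin 4) ℝ) (C : Tensor4) (n : Pt) : Prop :=
  IsNullVec g n ∧ ∀ a d e,
    contr2 C n a d * lower g n e - contr2 C n a e * lower g n d = 0

/-- Multiplicity at least three: `C_{abc[d} n_{e]} nᶜ = 0`. -/
def IsPNDGeThree (g : Matrix (Fin 4) (Fin 4) ℝ) (C : Tensor4) (n : Pt) : Prop :=
  IsNullVec g n ∧ ∀ a b d e,
    contr1 C n a b d * lower g n e - contr1 C n a b e * lower g n d = 0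

/-- `n` spans a principal null direction of multiplicity exactly two. -/
def IsDoublePND (g : Matrix (Fin 4) (Fin 4) ℝ) (C : Tensor4) (n : Pt) : Prop :=
  IsPNDGeTwo g C n ∧ ¬ IsPNDGeThree g C n

/-- `n₁` and `n₂` span two different directions, both are double principal null directions
of `C`, and `C` has no other principal null direction. -/
def HasDoublePNDPair (g : Matrix (Fin 4) (Fin 4) ℝ) (C : Tensor4) (n₁ n₂ : Pt) : Prop :=
  LinearIndependent ℝ ![n₁, n₂] ∧ IsDoublePND g C n₁ ∧ IsDoublePND g C n₂ ∧
    ∀ n, IsPND g C n → ∃ c : ℝ, n = c • n₁ ∨ n = c • n₂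

/-- Petrov type D (the principal null directions coincide in two pairs). -/
def IsPetrovTypeD (g : Matrix (Fin 4) (Fin 4) ℝ) (C : Tensor4) : Prop :=
  ∃ n₁ n₂ : Pt, HasDoublePNDPair g C n₁ n₂

/-! ### Null tetrads and Newman–Penrose scalars -/

/-- Complexification of a real vector. -/
def toC (u : Pt) : Fin 4 → ℂ := fun i => (u i : ℂ)

/-- Componentwise complex conjugate. -/
def conjVec (u : Fin 4 → ℂ) : Fin 4 → ℂ := fun i => starRingEnd ℂ (u i)

/-- The complex-bilinear extension of the metric. -/
def dotC (g : Matrix (Fin 4) (Fin 4) ℝ) (u v : Fin 4 → ℂ) : ℂ :=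
  ∑ a, ∑ b, (g a b : ℂ) * u a * v b

/-- `(l, k, m, m̄)` is a null tetrad with `l·k = -1`, `m·m̄ = 1`, all other products zero. -/
def IsNullTetrad (g : Matrix (Fin 4) (Fin 4) ℝ) (l k : Pt) (m : Fin 4 → ℂ) : Prop :=
  dotC g (toC l) (toC l) = 0 ∧ dotC g (toC k) (toC k) = 0 ∧
  dotC g m m = 0 ∧ dotC g (conjVec m) (conjVec m) = 0 ∧
  dotC g (toC l) (toC k) = -1 ∧ dotC g m (conjVec m) = 1 ∧
  dotC g (toC l) m = 0 ∧ dotC g (toC l) (conjVec m) = 0 ∧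
  dotC g (toC k) m = 0 ∧ dotC g (toC k) (conjVec m) = 0

/-- `C_{abcd} uᵃ vᵇ wᶜ zᵈ`. -/
def contr4 (C : Tensor4) (u v w z : Fin 4 → ℂ) : ℂ :=
  ∑ a, ∑ b, ∑ c, ∑ d, (C a b c d : ℂ) * u a * v b * w c * z d

def Psi0 (C : Tensor4) (l : Pt) (m : Fin 4 → ℂ) : ℂ :=
  contr4 C (toC l) m (toC l) m

def Psi1 (C : Tensor4) (l k : Pt) (m : Fin 4 → ℂ) : ℂ :=
  contr4 C (toC l) (toC k) (toC l) m

def Psi2 (C : Tensor4) (l k : Pt) (m : Fin 4 → ℂ) : ℂ :=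
  contr4 C (toC l) m (conjVec m) (toC k)

def Psi3 (C : Tensor4) (l k : Pt) (m : Fin 4 → ℂ) : ℂ :=
  contr4 C (toC k) (toC l) (toC k) (conjVec m)

def Psi4 (C : Tensor4) (k : Pt) (m : Fin 4 → ℂ) : ℂ :=
  contr4 C (toC k) (conjVec m) (toC k) (conjVec m)

/-! ### The Kerr-like metric and its tetrad; coordinates `(x 0, x 1, x 2, x 3) = (t, r, θ, φ)` -/

/-- `Σ = r² + a² cos² θ`. -/
def Sig (a : ℝ) (x : Pt) : ℝ := x 1 ^ 2 + a ^ 2 * Real.cos (x 2) ^ 2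

/-- `Δ_r = r² - 2 M(r) r + a²`. -/
def Del (a : ℝ) (M : ℝ → ℝ) (x : Pt) : ℝ := x 1 ^ 2 - 2 * M (x 1) * x 1 + a ^ 2

/-- The 1-form `dt - a sin² θ dφ`. -/
def formT (a : ℝ) (x : Pt) : Fin 4 → ℝ := ![1, 0, 0, -(a * Real.sin (x 2) ^ 2)]

/-- The 1-form `dr`. -/
def formR : Fin 4 → ℝ := ![0, 1, 0, 0]

/-- The 1-form `dθ`. -/
def formTheta : Fin 4 → ℝ := ![0, 0, 1, 0]

/-- The 1-form `a dt - (r² + a²) dφ`. -/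
def formPhi (a : ℝ) (x : Pt) : Fin 4 → ℝ := ![a, 0, 0, -(x 1 ^ 2 + a ^ 2)]

/-- The Kerr-like metric. -/
def metric (a : ℝ) (M : ℝ → ℝ) (x : Pt) : Matrix (Fin 4) (Fin 4) ℝ :=
  Matrix.of fun i j =>
    -(Del a M x / Sig a x) * (formT a x i * formT a x j)
      + Sig a x / Del a M x * (formR i * formR j)
      + Sig a x * (formTheta i * formTheta j)
      + Real.sin (x 2) ^ 2 / Sig a x * (formPhi a x i * formPhi a x j)

/-- The part of the chart with `r ∈ I`, `0 < θ < π` on which the metric is defined. -/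
def domain (a : ℝ) (M : ℝ → ℝ) (I : Set ℝ) : Set Pt :=
  {x | x 1 ∈ I ∧ x 2 ∈ Set.Ioo 0 Real.pi ∧ Sig a x ≠ 0 ∧ Del a M x ≠ 0}

/-- `ϱ = r + i a cos θ`. -/
def rhoC (a : ℝ) (x : Pt) : ℂ := (x 1 : ℂ) + Complex.I * ((a * Real.cos (x 2) : ℝ) : ℂ)

/-- `ϱ̄ = r - i a cos θ`. -/
def rhoBar (a : ℝ) (x : Pt) : ℂ := (x 1 : ℂ) - Complex.I * ((a * Real.cos (x 2) : ℝ) : ℂ)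

def vecL (a : ℝ) (M : ℝ → ℝ) (x : Pt) : Pt :=
  (1 / Del a M x) • ![x 1 ^ 2 + a ^ 2, Del a M x, 0, a]

def vecK (a : ℝ) (M : ℝ → ℝ) (x : Pt) : Pt :=
  (1 / (2 * Sig a x)) • ![x 1 ^ 2 + a ^ 2, -Del a M x, 0, a]

def vecM (a : ℝ) (x : Pt) : Fin 4 → ℂ :=
  (1 / ((Real.sqrt 2 : ℂ) * rhoC a x)) •
    ![Complex.I * ((a * Real.sin (x 2) : ℝ) : ℂ), 0, 1, Complex.I * ((1 / Real.sin (x 2) : ℝ) : ℂ)]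

/-- `Ψ₂` of the Weyl tensor of the Kerr-like metric in its tetrad. -/
def kerrPsi2 (a : ℝ) (M : ℝ → ℝ) (x : Pt) : ℂ :=
  Psi2 (weyl (metric a M) x) (vecL a M x) (vecK a M x) (vecM a x)

end KerrLike

end

noncomputable section

namespace KerrLike

open Matrix

/-! ### Curvature from a Christoffel symbol of the first kind -/

/-! The curvature is computed by Cartan's calculus in the coframe dt - a sin²θ dφ, dr, dθ, a dt -
(r² + a²) dφ, in which the metric is diagonal with coefficients -Δ/Σ, Σ/Δ, Σ, sin²θ/Σ. Leaving the
coframe unnormalised avoids square roots and any case distinction on the sign of Δ; the price is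
that the connection matrices have a symmetric (diagonal) part. The mass enters only through N = 2rM,
with Δ = r² + a² - N.

The connection `conn` is given explicitly. Compatibility with the metric (`hasPd_frameMetric`) and
vanishing torsion (`coframe_torsionFree`) identify it as the Levi-Civita connection, and
`riemann_eq_of_coframe` with `curvature_eq` then yields the Riemann tensor. It splits into a
trace-free tensor plus a product of the metric with a symmetric form, so the trace-free summand is
the Weyl tensor (`weyl_eq_of_decomposition`). By `weyl_metric` this summand is `typeDTensor` with
parameters p + iq, and evaluation on the tetrad gives Ψ₂ = p + iq and the vanishing of the other
four scalars.

The algebraic classification uses only the components of the tetrad in the coframe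
(`AdaptedTetrad`). The contraction of the tensor with l twice, or with k twice, is a multiple of the
square of the lowered vector, so both are at least double; a triple one would force Ψ₂ = 0. For any
other null n there is a complex u orthogonal to n with C(u,n,n,u) ≠ 0 (`detector`), which a
principal null vector forbids. Conversely, if Ψ₂ = 0 the whole tensor vanishes and no direction has
multiplicity exactly two.

For the density, Ψ₂ has the same zeros as its numerator. At fixed r ≠ 0, vanishing of the numerator
for two values of cos²θ gives three independent linear equations for M, M', M'', hence M(r) = 0
(`mass_eq_zero_of_psiNum`). So Ψ₂ cannot vanish on a nonempty open set where M ≠ 0. -/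

/-- Real `4 × 4` matrices. -/
abbrev Mat : Type := Matrix (Fin 4) (Fin 4) ℝ

/-- The matrix-valued function `A` has the entrywise partial derivative `A'` in direction `i`. -/
def HasPd (i : Fin 4) (A : Pt → Mat) (A' : Mat) (x : Pt) : Prop :=
  ∀ j k, HasDerivAt (fun s : ℝ => A (Function.update x i s) j k) (A' j k) (x i)

theorem HasPd.pd_eq {i : Fin 4} {A : Pt → Mat} {A' : Mat} {x : Pt} (h : HasPd i A A' x)
    (j k : Fin 4) : pd i (fun y => A y j k) x = A' j k :=
  (h j k).deriv

theorem HasPd.add {i : Fin 4} {A B : Pt → Mat} {A' B' : Mat} {x : Pt} (hA : HasPd i A A' x)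
    (hB : HasPd i B B' x) : HasPd i (fun y => A y + B y) (A' + B') x :=
  fun j k => (hA j k).add (hB j k)

theorem HasPd.transpose {i : Fin 4} {A : Pt → Mat} {A' : Mat} {x : Pt} (hA : HasPd i A A' x) :
    HasPd i (fun y => (A y)ᵀ) A'ᵀ x :=
  fun j k => hA k j

theorem HasPd.mul {i : Fin 4} {A B : Pt → Mat} {A' B' : Mat} {x : Pt} (hA : HasPd i A A' x)
    (hB : HasPd i B B' x) : HasPd i (fun y => A y * B y) (A' * B x + A x * B') x := by
  intro j k
  have h := HasDerivAt.fun_sum (u := Finset.univ)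
    (fun l _ => (hA j l).mul (hB l k))
  simp only [Function.update_eq_self] at h
  simp only [Matrix.mul_apply, Matrix.add_apply, ← Finset.sum_add_distrib]
  exact h

theorem HasPd.congr_of_eventuallyEq {i : Fin 4} {A B : Pt → Mat} {A' : Mat} {x : Pt}
    (hA : HasPd i A A' x) (h : ∀ᶠ y in nhds x, B y = A y) : HasPd i B A' x := by
  intro j k
  refine (hA j k).congr_of_eventuallyEq ?_
  have hc : Filter.Tendsto (fun s : ℝ => Function.update x i s) (nhds (x i)) (nhds x) := by
    have : Continuous (fun s : ℝ => Function.update x i s) := by fun_prop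
    simpa using this.tendsto (x i)
  filter_upwards [hc.eventually h] with s hs
  rw [hs]

theorem HasPd.unique {i : Fin 4} {A : Pt → Mat} {A' A'' : Mat} {x : Pt}
    (h : HasPd i A A' x) (h' : HasPd i A A'' x) : A' = A'' := by
  ext j k
  exact (h j k).unique (h' j k)

theorem differentiableAt_det {n : ℕ} {A : ℝ → Matrix (Fin n) (Fin n) ℝ} {s : ℝ}
    (h : ∀ j k, DifferentiableAt ℝ (fun t => A t j k) s) :
    DifferentiableAt ℝ (fun t => (A t).det) s := by
  simp only [Matrix.det_apply']
  refine DifferentiableAt.fun_sum fun σ _ => DifferentiableAt.const_mul ?_ _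
  exact DifferentiableAt.fun_finsetProd fun k _ => h _ _

/-- Existence is enough: the value of the derivative of the inverse is never needed, because
differentiating g (g⁻¹ L) = L eliminates it. -/
theorem HasPd.exists_inv {i : Fin 4} {A : Pt → Mat} {A' : Mat} {x : Pt} (h : HasPd i A A' x)
    (hdet : (A x).det ≠ 0) : ∃ B', HasPd i (fun y => (A y)⁻¹) B' x := by
  have hd : ∀ j k, DifferentiableAt ℝ (fun s => A (Function.update x i s) j k) (x i) :=
    fun j k => (h j k).differentiableAt
  refine ⟨Matrix.of fun j k => deriv (fun s => (A (Function.update x i s))⁻¹ j k) (x i), ?_⟩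
  intro j k
  rw [Matrix.of_apply]
  refine DifferentiableAt.hasDerivAt ?_
  simp only [Matrix.inv_def, Matrix.smul_apply, Matrix.adjugate_apply, Ring.inverse_eq_inv',
    smul_eq_mul]
  refine DifferentiableAt.fun_mul (DifferentiableAt.fun_inv (differentiableAt_det hd) ?_)
    (differentiableAt_det fun a b => ?_)
  · simpa using hdet
  · by_cases hak : a = k
    · subst hak
      simp
    · simpa [Matrix.updateRow_ne hak] using hd a b

/-- The Christoffel symbols are determined by the symmetric, metric symbol of the first kind. -/
theorem christoffel_eq {g : Pt → Mat} {x : Pt} {L dg : Fin 4 → Mat}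
    (hdg : ∀ c, HasPd c g (dg c) x)
    (hcompat : ∀ c, dg c = L c + (L c)ᵀ) (hsymm : ∀ b c d, L c d b = L b d c) (a b c : Fin 4) :
    christoffel g a b c x = ((g x)⁻¹ * L c) a b := by
  rw [christoffel, Matrix.mul_apply, Finset.mul_sum]
  refine Finset.sum_congr rfl fun d _ => ?_
  rw [(hdg b).pd_eq, (hdg c).pd_eq, (hdg d).pd_eq, hcompat, hcompat, hcompat]
  simp only [Matrix.add_apply, Matrix.transpose_apply]
  rw [hsymm c b d, hsymm d b c, hsymm d c b]
  ring

/-- The Riemann tensor in terms of the Christoffel symbol of the first kind `L`: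
`R_{··cd} = ∂_c L_d - ∂_d L_c - L_cᵀ g⁻¹ L_d + L_dᵀ g⁻¹ L_c`. -/
theorem riemann_eq {U : Set Pt} (hU : IsOpen U) {g : Pt → Mat} {L dg : Fin 4 → Pt → Mat}
    {dL : Fin 4 → Fin 4 → Pt → Mat}
    (hdg : ∀ x ∈ U, ∀ c, HasPd c g (dg c x) x) (hdet : ∀ x ∈ U, (g x).det ≠ 0)
    (hcompat : ∀ x ∈ U, ∀ c, dg c x = L c x + (L c x)ᵀ)
    (hsymm : ∀ x ∈ U, ∀ b c d, L c x d b = L b x d c)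
    (hdL : ∀ x ∈ U, ∀ c d, HasPd c (L d) (dL c d x) x)
    {x : Pt} (hx : x ∈ U) (a b c d : Fin 4) :
    riemann g x a b c d =
      (dL c d x - dL d c x - (L c x)ᵀ * (g x)⁻¹ * L d x + (L d x)ᵀ * (g x)⁻¹ * L c x) a b := by
  have hΓ : ∀ y ∈ U, ∀ a b c, christoffel g a b c y = ((g y)⁻¹ * L c y) a b := fun y hy a b c =>
    christoffel_eq (hdg y hy) (hcompat y hy) (hsymm y hy) a b c
  have hunit : IsUnit (g x).det := isUnit_iff_ne_zero.mpr (hdet x hx)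
  have hdG : ∀ c d, ∃ G', HasPd c (fun y => (g y)⁻¹ * L d y) G' x := fun c d => by
    obtain ⟨B', hB'⟩ := (hdg x hx c).exists_inv (hdet x hx)
    exact ⟨_, hB'.mul (hdL x hx c d)⟩
  choose dG hdG using hdG
  have hpd : ∀ a b c d, pd c (christoffel g a b d) x = dG c d a b := by
    intro a b c d
    have h1 : HasPd c (fun y => Matrix.of fun a b => christoffel g a b d y) (dG c d) x := by
      refine (hdG c d).congr_of_eventuallyEq ?_
      filter_upwards [hU.mem_nhds hx] with y hy
      ext a b
      rw [Matrix.of_apply, hΓ y hy]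
    exact h1.pd_eq a b
  -- The product rule for g (g⁻¹ L) = L gives g ∂(g⁻¹ L) = ∂L - (∂g) g⁻¹ L. As ∂g = L + Lᵀ, the L
  -- part cancels the quadratic term of the curvature and Lᵀ takes its place.
  have hgG : ∀ c d, dg c x * ((g x)⁻¹ * L d x) + g x * dG c d = dL c d x := by
    intro c d
    refine HasPd.unique ((hdg x hx c).mul (hdG c d)) ((hdL x hx c d).congr_of_eventuallyEq ?_)
    filter_upwards [hU.mem_nhds hx] with y hy
    rw [← Matrix.mul_assoc, Matrix.mul_nonsing_inv _ (isUnit_iff_ne_zero.mpr (hdet y hy)),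
      Matrix.one_mul]
  have hup : ∀ e b, riemannUp g x e b c d =
      (dG c d - dG d c + ((g x)⁻¹ * L c x) * ((g x)⁻¹ * L d x)
        - ((g x)⁻¹ * L d x) * ((g x)⁻¹ * L c x)) e b := by
    intro e b
    have hs : ∀ a c e, ((g x)⁻¹ * L e x) a c = ((g x)⁻¹ * L c x) a e := by
      intro a c e
      simp only [Matrix.mul_apply]
      exact Finset.sum_congr rfl fun k _ => by rw [hsymm x hx c e k]
    rw [riemannUp, hpd, hpd]
    simp only [hΓ x hx]
    rw [Matrix.sub_apply, Matrix.add_apply, Matrix.sub_apply, Matrix.mul_apply, Matrix.mul_apply,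
      Finset.sum_sub_distrib, ← add_sub_assoc]
    simp only [hs e c, hs e d]
  have hL : ∀ c, g x * ((g x)⁻¹ * L c x) = L c x := fun c => by
    rw [← Matrix.mul_assoc, Matrix.mul_nonsing_inv _ hunit, Matrix.one_mul]
  have hlow : riemann g x a b c d = (g x * (dG c d - dG d c
      + ((g x)⁻¹ * L c x) * ((g x)⁻¹ * L d x) - ((g x)⁻¹ * L d x) * ((g x)⁻¹ * L c x))) a b := by
    rw [riemann, Matrix.mul_apply]
    exact Finset.sum_congr rfl fun e _ => by rw [hup]
  rw [hlow, ← hgG c d, ← hgG d c, hcompat x hx c, hcompat x hx d]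
  have e1 : g x * (((g x)⁻¹ * L c x) * ((g x)⁻¹ * L d x)) = L c x * ((g x)⁻¹ * L d x) := by
    rw [← Matrix.mul_assoc, hL]
  have e2 : g x * (((g x)⁻¹ * L d x) * ((g x)⁻¹ * L c x)) = L d x * ((g x)⁻¹ * L c x) := by
    rw [← Matrix.mul_assoc, hL]
  rw [Matrix.mul_sub, Matrix.mul_add, Matrix.mul_sub, e1, e2]
  refine congrFun (congrFun ?_ a) b
  noncomm_ring

/-- Cartan's second structure equation: in a coframe `Θ` with metric `g = Θᵀ h Θ` and connection
matrices `α`, lowered with `h`, the Riemann tensor is `Θᵀ F Θ` with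
`F_{cd} = ∂_c α_d - ∂_d α_c - α_cᵀ h⁻¹ α_d + α_dᵀ h⁻¹ α_c`. -/
theorem riemann_eq_of_coframe {U : Set Pt} (hU : IsOpen U) {g Θ h : Pt → Mat}
    {dΘ dh α : Fin 4 → Pt → Mat} {ddΘ dα : Fin 4 → Fin 4 → Pt → Mat}
    (hg : ∀ x, g x = (Θ x)ᵀ * h x * Θ x)
    (hΘdet : ∀ x ∈ U, (Θ x).det ≠ 0) (hhdet : ∀ x ∈ U, (h x).det ≠ 0)
    (hhT : ∀ x, (h x)ᵀ = h x)
    (hdΘ : ∀ x ∈ U, ∀ c, HasPd c Θ (dΘ c x) x)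
    (hddΘ : ∀ x ∈ U, ∀ c d, HasPd c (dΘ d) (ddΘ c d x) x)
    (hddΘ_symm : ∀ x ∈ U, ∀ c d, ddΘ c d x = ddΘ d c x)
    (hdh : ∀ x ∈ U, ∀ c, HasPd c h (dh c x) x)
    (hdα : ∀ x ∈ U, ∀ c d, HasPd c (α d) (dα c d x) x)
    (hmetric : ∀ x ∈ U, ∀ c, dh c x = α c x + (α c x)ᵀ)
    (htorsion : ∀ x ∈ U, ∀ i b c,
      (h x * dΘ c x + α c x * Θ x) i b = (h x * dΘ b x + α b x * Θ x) i c)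
    {x : Pt} (hx : x ∈ U) (a b c d : Fin 4) :
    riemann g x a b c d =
      ((Θ x)ᵀ * (dα c d x - dα d c x - (α c x)ᵀ * (h x)⁻¹ * α d x
        + (α d x)ᵀ * (h x)⁻¹ * α c x) * Θ x) a b := by
  have hgf : g = fun x => (Θ x)ᵀ * h x * Θ x := funext hg
  have hdg : ∀ x ∈ U, ∀ c, HasPd c g
      (((dΘ c x)ᵀ * h x + (Θ x)ᵀ * dh c x) * Θ x + (Θ x)ᵀ * h x * dΘ c x) x := by
    intro x hx c
    rw [hgf]
    exact ((hdΘ x hx c).transpose.mul (hdh x hx c)).mul (hdΘ x hx c)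
  -- The symbol of the first kind is L_d = Θᵀ (h ∂_d Θ + α_d Θ): the condition on ∂h makes it
  -- metric, and the torsion condition is exactly its symmetry.
  have hdL : ∀ x ∈ U, ∀ c d, HasPd c (fun y => (Θ y)ᵀ * (h y * dΘ d y + α d y * Θ y))
      ((dΘ c x)ᵀ * (h x * dΘ d x + α d x * Θ x) + (Θ x)ᵀ * ((dh c x * dΘ d x + h x * ddΘ c d x)
        + (dα c d x * Θ x + α d x * dΘ c x))) x := fun x hx c d =>
    (hdΘ x hx c).transpose.mul (((hdh x hx c).mul (hddΘ x hx c d)).add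
      ((hdα x hx c d).mul (hdΘ x hx c)))
  rw [riemann_eq hU (g := g) (L := fun d y => (Θ y)ᵀ * (h y * dΘ d y + α d y * Θ y))
    (dg := fun c x => ((dΘ c x)ᵀ * h x + (Θ x)ᵀ * dh c x) * Θ x + (Θ x)ᵀ * h x * dΘ c x)
    (dL := fun c d x => (dΘ c x)ᵀ * (h x * dΘ d x + α d x * Θ x) + (Θ x)ᵀ * ((dh c x * dΘ d x
      + h x * ddΘ c d x) + (dα c d x * Θ x + α d x * dΘ c x))) hdg ?_ ?_ ?_ hdL hx]
  · have hΘ2 : Θ x * (Θ x)⁻¹ = 1 := Matrix.mul_nonsing_inv _ (isUnit_iff_ne_zero.mpr (hΘdet x hx))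
    have hh1 : h x * (h x)⁻¹ = 1 := Matrix.mul_nonsing_inv _ (isUnit_iff_ne_zero.mpr (hhdet x hx))
    have hh2 : (h x)⁻¹ * h x = 1 := Matrix.nonsing_inv_mul _ (isUnit_iff_ne_zero.mpr (hhdet x hx))
    have hquad : ∀ c d, ((Θ x)ᵀ * (h x * dΘ c x + α c x * Θ x))ᵀ * (g x)⁻¹ *
        ((Θ x)ᵀ * (h x * dΘ d x + α d x * Θ x)) = (dΘ c x)ᵀ * h x * dΘ d x
          + (dΘ c x)ᵀ * α d x * Θ x + (Θ x)ᵀ * (α c x)ᵀ * dΘ d x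
          + (Θ x)ᵀ * (α c x)ᵀ * (h x)⁻¹ * α d x * Θ x := by
      intro c d
      have hΘT : ((Θ x)ᵀ)⁻¹ * (Θ x)ᵀ = 1 := by
        rw [← Matrix.transpose_nonsing_inv, ← Matrix.transpose_mul, hΘ2, Matrix.transpose_one]
      have hinv : Θ x * (g x)⁻¹ * (Θ x)ᵀ = (h x)⁻¹ := by
        rw [hg, Matrix.mul_inv_rev, Matrix.mul_inv_rev]
        calc Θ x * ((Θ x)⁻¹ * ((h x)⁻¹ * ((Θ x)ᵀ)⁻¹)) * (Θ x)ᵀ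
            = (Θ x * (Θ x)⁻¹) * (h x)⁻¹ * (((Θ x)ᵀ)⁻¹ * (Θ x)ᵀ) := by
              simp only [Matrix.mul_assoc]
          _ = (h x)⁻¹ := by rw [hΘ2, hΘT, Matrix.one_mul, Matrix.mul_one]
      calc _ = (h x * dΘ c x + α c x * Θ x)ᵀ * (Θ x * (g x)⁻¹ * (Θ x)ᵀ)
              * (h x * dΘ d x + α d x * Θ x) := by
            rw [Matrix.transpose_mul, Matrix.transpose_transpose]
            simp only [Matrix.mul_assoc]
        _ = (dΘ c x)ᵀ * (h x * (h x)⁻¹) * h x * dΘ d x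
              + (dΘ c x)ᵀ * (h x * (h x)⁻¹) * α d x * Θ x
              + (Θ x)ᵀ * (α c x)ᵀ * ((h x)⁻¹ * h x) * dΘ d x
              + (Θ x)ᵀ * (α c x)ᵀ * (h x)⁻¹ * α d x * Θ x := by
            rw [hinv, Matrix.transpose_add, Matrix.transpose_mul, Matrix.transpose_mul, hhT]
            noncomm_ring
        _ = _ := by rw [hh1, hh2, Matrix.mul_one, Matrix.mul_one]
    -- Three of the four quadratic terms cancel against ∂L. What is left besides the curvature form
    -- is Θᵀ (α_c ∂_d Θ + α_d ∂_c Θ) and Θᵀ h ∂_c ∂_d Θ, both symmetric in c, d.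
    simp only [hquad]
    rw [hddΘ_symm x hx d c, hmetric x hx c, hmetric x hx d]
    refine congrFun (congrFun ?_ a) b
    noncomm_ring
  · intro x hx
    rw [hg, Matrix.det_mul, Matrix.det_mul, Matrix.det_transpose]
    exact mul_ne_zero (mul_ne_zero (hΘdet x hx) (hhdet x hx)) (hΘdet x hx)
  · intro x hx c
    simp only [hmetric x hx c, Matrix.transpose_mul, Matrix.transpose_add,
      Matrix.transpose_transpose, hhT]
    noncomm_ring
  · intro x hx b c d
    simp only [Matrix.mul_apply (M := (Θ x)ᵀ)]
    exact Finset.sum_congr rfl fun i _ => by rw [htorsion x hx i b c]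

/-! ### The Weyl tensor as the trace-free part -/

/-- If the Riemann tensor is a trace-free tensor `W` plus half the Kulkarni–Nomizu product of the
metric with a bilinear form `P`, then the Weyl tensor is `W`. -/
theorem weyl_eq_of_decomposition {g : Pt → Mat} {x : Pt} (hdet : (g x).det ≠ 0)
    (hsymm : ∀ a b, g x a b = g x b a) {W : Tensor4} {P : Mat}
    (hR : ∀ a b c d, riemann g x a b c d = W a b c d
      + (1 / 2) * (g x a c * P b d - g x a d * P b c - g x b c * P a d + g x b d * P a c))
    (hW : ∀ b d, ∑ a, ∑ c, (g x)⁻¹ a c * W a b c d = 0) :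
    weyl g x = W := by
  have hunit : IsUnit (g x).det := isUnit_iff_ne_zero.mpr hdet
  have hJsymm : ∀ a b, (g x)⁻¹ a b = (g x)⁻¹ b a := by
    intro a b
    have hT : (g x)ᵀ = g x := by
      ext a b
      exact hsymm b a
    have h := Matrix.transpose_nonsing_inv (g x)
    rw [hT] at h
    exact congrFun (congrFun h b) a
  have hJg : ∀ a b, ∑ e, (g x)⁻¹ a e * g x e b = if a = b then 1 else 0 := by
    intro a b
    rw [← Matrix.mul_apply, Matrix.nonsing_inv_mul _ hunit, Matrix.one_apply]
  have hup : ∀ a b c d, riemannUp g x a b c d = ∑ e, (g x)⁻¹ a e * riemann g x e b c d := by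
    intro a b c d
    simp only [riemann, Finset.mul_sum]
    rw [Finset.sum_comm]
    simp only [← mul_assoc, ← Finset.sum_mul, hJg]
    simp
  set t : ℝ := ∑ a, ∑ c, (g x)⁻¹ a c * P a c with ht
  have e1 : ∀ b d, ∑ a, ∑ c, (g x)⁻¹ a c * (g x c a * P b d) = 4 * P b d := by
    intro b d
    simp only [← mul_assoc, ← Finset.sum_mul, hJg]
    simp
  have e2 : ∀ b d, ∑ a, ∑ c, (g x)⁻¹ a c * (g x c d * P b a) = P b d := by
    intro b d
    simp only [← mul_assoc, ← Finset.sum_mul, hJg]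
    simp
  have e3 : ∀ b d, ∑ a, ∑ c, (g x)⁻¹ a c * (g x b a * P c d) = P b d := by
    intro b d
    rw [Finset.sum_comm]
    have : ∀ a c, (g x)⁻¹ a c * (g x b a * P c d) = (g x)⁻¹ c a * g x a b * P c d := by
      intro a c
      rw [hJsymm a c, hsymm b a]
      ring
    simp only [this, ← Finset.sum_mul, hJg]
    simp
  have e4 : ∀ b d, ∑ a, ∑ c, (g x)⁻¹ a c * (g x b d * P c a) = t * g x b d := by
    intro b d
    rw [ht, Finset.sum_comm, Finset.sum_mul]
    refine Finset.sum_congr rfl fun a _ => ?_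
    rw [Finset.sum_mul]
    refine Finset.sum_congr rfl fun c _ => ?_
    rw [hJsymm c a]
    ring
  -- Only the product with P contributes to the trace, so Ric = P + (t/2) g. Then the scalar
  -- curvature is 3t, and the terms in t cancel in the Weyl tensor.
  have hric : ∀ b d, ricci g x b d = P b d + t / 2 * g x b d := by
    intro b d
    have hW' : ∑ a, ∑ c, (g x)⁻¹ a c * W c b a d = 0 := by
      rw [← hW b d, Finset.sum_comm]
      simp only [hJsymm]
    have : ricci g x b d = ∑ a, ∑ c, (g x)⁻¹ a c * W c b a d
        + (1 / 2) * (∑ a, ∑ c, (g x)⁻¹ a c * (g x c a * P b d)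
          - ∑ a, ∑ c, (g x)⁻¹ a c * (g x c d * P b a)
          - ∑ a, ∑ c, (g x)⁻¹ a c * (g x b a * P c d)
          + ∑ a, ∑ c, (g x)⁻¹ a c * (g x b d * P c a)) := by
      simp only [ricci, hup, hR, ← Finset.sum_sub_distrib, ← Finset.sum_add_distrib,
        Finset.mul_sum]
      exact Finset.sum_congr rfl fun a _ => Finset.sum_congr rfl fun c _ => by ring
    rw [this, hW', e1, e2, e3, e4]
    ring
  have hscal : scalarCurv g x = 3 * t := by
    have e5 : ∑ b, ∑ d, (g x)⁻¹ b d * g x b d = 4 := by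
      have h2 : ∀ b, ∑ d, (g x)⁻¹ b d * g x b d = 1 := by
        intro b
        have := hJg b b
        simp only [if_true] at this
        rw [← this]
        exact Finset.sum_congr rfl fun d _ => by rw [hsymm b d]
      simp [h2]
    have : scalarCurv g x = ∑ b, ∑ d, (g x)⁻¹ b d * P b d
        + t / 2 * ∑ b, ∑ d, (g x)⁻¹ b d * g x b d := by
      simp only [scalarCurv, hric, Finset.mul_sum, ← Finset.sum_add_distrib]
      exact Finset.sum_congr rfl fun a _ => Finset.sum_congr rfl fun c _ => by ring
    rw [this, e5, ← ht]
    ring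
  funext a b c d
  simp only [weyl, hR, hric, hscal]
  rw [hsymm b c]
  ring

/-! ### Products of simple two-forms -/

/-- The simple two-form `u ∧ v`. -/
def bivec (u v : Fin 4 → ℝ) (a b : Fin 4) : ℝ := u a * v b - u b * v a

/-- The product `(u ∧ v)_{ab} (w ∧ z)_{cd}`. -/
def biprod (u v w z : Fin 4 → ℝ) : Tensor4 := fun a b c d => bivec u v a b * bivec w z c d

/-- The trace of a bilinear form with respect to `J`. -/
def trace2 (J : Mat) (T : Fin 4 → Fin 4 → ℝ) : ℝ := ∑ a, ∑ c, J a c * T a c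

theorem trace2_add (J : Mat) (T T' : Fin 4 → Fin 4 → ℝ) :
    trace2 J (fun a c => T a c + T' a c) = trace2 J T + trace2 J T' := by
  simp only [trace2, mul_add, Finset.sum_add_distrib]

theorem trace2_smul (J : Mat) (r : ℝ) (T : Fin 4 → Fin 4 → ℝ) :
    trace2 J (fun a c => r * T a c) = r * trace2 J T := by
  simp only [trace2, Finset.mul_sum]
  exact Finset.sum_congr rfl fun a _ => Finset.sum_congr rfl fun c _ => by ring

theorem trace2_biprod (J : Mat) (u v w z : Fin 4 → ℝ) (b d : Fin 4) :
    trace2 J (fun a c => biprod u v w z a b c d) =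
      trace2 J (fun a c => u a * w c) * (v b * z d) - trace2 J (fun a c => u a * z c) * (v b * w d)
        - trace2 J (fun a c => v a * w c) * (u b * z d)
        + trace2 J (fun a c => v a * z c) * (u b * w d) := by
  simp only [trace2, Finset.sum_mul, ← Finset.sum_sub_distrib, ← Finset.sum_add_distrib, biprod,
    bivec]
  exact Finset.sum_congr rfl fun a _ => Finset.sum_congr rfl fun c _ => by ring

/-- Evaluation of a real covector on a complex vector. -/
def pairC (α : Fin 4 → ℝ) (u : Fin 4 → ℂ) : ℂ := ∑ a, (α a : ℂ) * u a

/-- Evaluation of a simple two-form on two complex vectors. -/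
def bivecC (α β : Fin 4 → ℝ) (u v : Fin 4 → ℂ) : ℂ :=
  pairC α u * pairC β v - pairC α v * pairC β u

/-- Each contraction factors into two 2 × 2 minors of coframe components, so every later evaluation
on the tetrad is arithmetic with components. -/
theorem contr4_biprod (α β γ δ : Fin 4 → ℝ) (u v w z : Fin 4 → ℂ) :
    contr4 (biprod α β γ δ) u v w z = bivecC α β u v * bivecC γ δ w z := by
  have h : ∀ (α β : Fin 4 → ℝ) (u v : Fin 4 → ℂ),
      bivecC α β u v = ∑ a, ∑ b, (bivec α β a b : ℂ) * u a * v b := by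
    intro α β u v
    simp only [bivecC, pairC, Fin.sum_univ_four, bivec]
    push_cast
    ring
  rw [h, h, mul_comm]
  simp only [contr4, Finset.sum_mul, Finset.mul_sum, biprod]
  refine Finset.sum_congr rfl fun a _ => ?_
  refine Finset.sum_congr rfl fun b _ => ?_
  refine Finset.sum_congr rfl fun c _ => ?_
  refine Finset.sum_congr rfl fun d _ => ?_
  push_cast
  ring

theorem contr4_add (C C' : Tensor4) (u v w z : Fin 4 → ℂ) :
    contr4 (C + C') u v w z = contr4 C u v w z + contr4 C' u v w z := by
  simp only [contr4, Pi.add_apply, Complex.ofReal_add, add_mul, Finset.sum_add_distrib]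

theorem contr4_smul (r : ℝ) (C : Tensor4) (u v w z : Fin 4 → ℂ) :
    contr4 (r • C) u v w z = r * contr4 C u v w z := by
  simp only [contr4, Pi.smul_apply, smul_eq_mul, Complex.ofReal_mul, Finset.mul_sum, mul_assoc]

/-! ### Tensors of type D in an adapted coframe -/

/-- The Weyl tensor of type D with `Ψ₂ = p + i q` in the coframe `θ` in which the metric is
diagonal with entries `-D/S`, `S/D`, `S`, `s²/S`. -/
def typeDTensor (S D s p q : ℝ) (θ : Mat) : Tensor4 :=
  p • ((2 : ℝ) • biprod (θ 0) (θ 1) (θ 0) (θ 1) + (-2 * s ^ 2) • biprod (θ 2) (θ 3) (θ 2) (θ 3)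
      + (-D) • biprod (θ 0) (θ 2) (θ 0) (θ 2) + (s ^ 2 / D) • biprod (θ 1) (θ 3) (θ 1) (θ 3)
      + (-(D * s ^ 2 / S ^ 2)) • biprod (θ 0) (θ 3) (θ 0) (θ 3)
      + (S ^ 2 / D) • biprod (θ 1) (θ 2) (θ 1) (θ 2))
    + (q * s) • ((2 : ℝ) • (biprod (θ 0) (θ 1) (θ 2) (θ 3) + biprod (θ 2) (θ 3) (θ 0) (θ 1))
      + (biprod (θ 0) (θ 2) (θ 1) (θ 3) + biprod (θ 1) (θ 3) (θ 0) (θ 2))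
      + (-1 : ℝ) • (biprod (θ 0) (θ 3) (θ 1) (θ 2) + biprod (θ 1) (θ 2) (θ 0) (θ 3)))

/-- The diagonal metric coefficients in the coframe. -/
def diagCoeff (S D s : ℝ) : Fin 4 → ℝ := ![-(D / S), S / D, S, s ^ 2 / S]

/-- Measured in units of h_i h_j, with h the diagonal coefficients, the terms in p have weight -2 on
the pairs 01 and 23 and weight 1 on the other four, so each coframe index collects -2 + 1 + 1 = 0.
The terms in q join complementary pairs, whose traces only meet distinct coframe elements and hence
vanish. -/
theorem typeDTensor_traceFree {S D s p q : ℝ} {θ : Mat} (hS : S ≠ 0) (hD : D ≠ 0)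
    (hs : s ≠ 0) {J : Mat}
    (hJ : ∀ i j, trace2 J (fun a c => θ i a * θ j c)
      = if i = j then (diagCoeff S D s i)⁻¹ else 0) (b d : Fin 4) :
    ∑ a, ∑ c, J a c * typeDTensor S D s p q θ a b c d = 0 := by
  change trace2 J (fun a c => typeDTensor S D s p q θ a b c d) = 0
  simp only [typeDTensor, Pi.add_apply, Pi.smul_apply, smul_eq_mul, trace2_add, trace2_smul,
    trace2_biprod, hJ]
  simp [diagCoeff]
  right
  field_simp
  ring

theorem contr4_typeDTensor (S D s p q : ℝ) (θ : Mat) (u v w z : Fin 4 → ℂ) :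
    contr4 (typeDTensor S D s p q θ) u v w z =
      p * (2 * (bivecC (θ 0) (θ 1) u v * bivecC (θ 0) (θ 1) w z)
          - 2 * s ^ 2 * (bivecC (θ 2) (θ 3) u v * bivecC (θ 2) (θ 3) w z)
          - D * (bivecC (θ 0) (θ 2) u v * bivecC (θ 0) (θ 2) w z)
          + s ^ 2 / D * (bivecC (θ 1) (θ 3) u v * bivecC (θ 1) (θ 3) w z)
          - D * s ^ 2 / S ^ 2 * (bivecC (θ 0) (θ 3) u v * bivecC (θ 0) (θ 3) w z)
          + S ^ 2 / D * (bivecC (θ 1) (θ 2) u v * bivecC (θ 1) (θ 2) w z))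
        + q * s * (2 * (bivecC (θ 0) (θ 1) u v * bivecC (θ 2) (θ 3) w z
            + bivecC (θ 2) (θ 3) u v * bivecC (θ 0) (θ 1) w z)
          + (bivecC (θ 0) (θ 2) u v * bivecC (θ 1) (θ 3) w z
            + bivecC (θ 1) (θ 3) u v * bivecC (θ 0) (θ 2) w z)
          - (bivecC (θ 0) (θ 3) u v * bivecC (θ 1) (θ 2) w z
            + bivecC (θ 1) (θ 2) u v * bivecC (θ 0) (θ 3) w z)) := by
  simp only [typeDTensor, contr4_add, contr4_smul, contr4_biprod]
  push_cast
  ring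

/-! ### The connection of the Kerr-like metric in its natural coframe -/

/-- The partial derivatives of a function of `r` and `θ` only. -/
def coordDeriv (Ar At : Mat) (i : Fin 4) : Mat :=
  if i = 1 then Ar else if i = 2 then At else 0

theorem coordDeriv_zero (Ar At : Mat) : coordDeriv Ar At 0 = 0 := rfl

theorem coordDeriv_one (Ar At : Mat) : coordDeriv Ar At 1 = Ar := rfl

theorem coordDeriv_two (Ar At : Mat) : coordDeriv Ar At 2 = At := rfl

theorem coordDeriv_three (Ar At : Mat) : coordDeriv Ar At 3 = 0 := rfl

theorem hasPd_of_coords {A : ℝ → ℝ → Mat} {Ar At : Mat} {x : Pt}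
    (hr : ∀ j k, HasDerivAt (fun r => A r (x 2) j k) (Ar j k) (x 1))
    (ht : ∀ j k, HasDerivAt (fun t => A (x 1) t j k) (At j k) (x 2)) (i : Fin 4) :
    HasPd i (fun y => A (y 1) (y 2)) (coordDeriv Ar At i) x := by
  intro j k
  fin_cases i
  · exact hasDerivAt_const (x 0) (A (x 1) (x 2) j k)
  · exact hr j k
  · exact ht j k
  · exact hasDerivAt_const (x 3) (A (x 1) (x 2) j k)

/-- The matrix with diagonal `d` and skew off-diagonal part `w`, the pairs being ordered as
`01, 02, 03, 12, 13, 23`. -/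
def connMat (d : Fin 4 → ℝ) (w : Fin 6 → ℝ) : Mat :=
  !![d 0, w 0, w 1, w 2; -w 0, d 1, w 3, w 4; -w 1, -w 3, d 2, w 5; -w 2, -w 4, -w 5, d 3]

theorem hasDerivAt_connMat {d : ℝ → Fin 4 → ℝ} {w : ℝ → Fin 6 → ℝ} {d' : Fin 4 → ℝ}
    {w' : Fin 6 → ℝ} {s : ℝ} (hd : ∀ i, HasDerivAt (fun t => d t i) (d' i) s)
    (hw : ∀ i, HasDerivAt (fun t => w t i) (w' i) s) (j k : Fin 4) :
    HasDerivAt (fun t => connMat (d t) (w t) j k) (connMat d' w' j k) s := by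
  fin_cases j <;> fin_cases k <;>
    first
    | exact hd _
    | exact hw _
    | exact (hw _).neg

theorem hasDerivAt_diagonal {d : ℝ → Fin 4 → ℝ} {d' : Fin 4 → ℝ} {s : ℝ}
    (hd : ∀ i, HasDerivAt (fun t => d t i) (d' i) s) (j k : Fin 4) :
    HasDerivAt (fun t => Matrix.diagonal (d t) j k) (Matrix.diagonal d' j k) s := by
  by_cases h : j = k
  · subst h
    simpa using hd j
  · simpa [Matrix.diagonal_apply_ne _ h] using hasDerivAt_const s (0 : ℝ)

/-- The off-diagonal part of the quadratic term in the structure equation. -/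
def quadSkew (k : Fin 4 → ℝ) (A B : Mat) : Fin 6 → ℝ :=
  let f := fun i j => ∑ l, k l * (A l i * B l j - B l i * A l j)
  ![f 0 1, f 0 2, f 0 3, f 1 2, f 1 3, f 2 3]

/-- The second product is the transpose of the first, so the difference is skew and six entries
determine it. -/
theorem connMat_quadratic (k : Fin 4 → ℝ) (A B : Mat) :
    Aᵀ * Matrix.diagonal k * B - Bᵀ * Matrix.diagonal k * A = connMat 0 (quadSkew k A B) := by
  ext i j
  fin_cases i <;> fin_cases j <;>
    simp [connMat, quadSkew, Matrix.mul_apply, Fin.sum_univ_four, Matrix.diagonal] <;> ring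

theorem connMat_sub (d d' : Fin 4 → ℝ) (w w' : Fin 6 → ℝ) :
    connMat d w - connMat d' w' = connMat (d - d') (w - w') := by
  ext i j
  fin_cases i <;> fin_cases j <;> simp [connMat] <;> ring

/-- A skew two-tensor written through the two-forms of a coframe. -/
theorem coframe_connMat (Θ : Mat) (w : Fin 6 → ℝ) (a b : Fin 4) :
    (Θᵀ * connMat 0 w * Θ) a b =
      w 0 * bivec (Θ 0) (Θ 1) a b + w 1 * bivec (Θ 0) (Θ 2) a b + w 2 * bivec (Θ 0) (Θ 3) a b
      + w 3 * bivec (Θ 1) (Θ 2) a b + w 4 * bivec (Θ 1) (Θ 3) a b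
      + w 5 * bivec (Θ 2) (Θ 3) a b := by
  simp [Matrix.mul_apply, Fin.sum_univ_four, connMat, bivec]
  ring

/-- The coframe `dt - a sin² θ dφ`, `dr`, `dθ`, `a dt - (r² + a²) dφ`. -/
def coframe (a r t : ℝ) : Mat :=
  !![1, 0, 0, -(a * Real.sin t ^ 2); 0, 1, 0, 0; 0, 0, 1, 0; a, 0, 0, -(r ^ 2 + a ^ 2)]

/-- The first partial derivatives of the coframe. -/
def coframeDeriv (a : ℝ) (c : Fin 4) (r t : ℝ) : Mat :=
  coordDeriv (Matrix.single 3 3 (-(2 * r)))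
    (Matrix.single 0 3 (-(a * (2 * Real.sin t * Real.cos t)))) c

/-- The second partial derivatives of the coframe. -/
def coframeDeriv2 (a : ℝ) (c d : Fin 4) (t : ℝ) : Mat :=
  coordDeriv (coordDeriv (Matrix.single 3 3 (-2)) 0 d) (coordDeriv 0
    (Matrix.single 0 3 (-(2 * a * (Real.cos t ^ 2 - Real.sin t ^ 2)))) d) c

theorem coframeDeriv2_symm (a : ℝ) (c d : Fin 4) (t : ℝ) :
    coframeDeriv2 a c d t = coframeDeriv2 a d c t := by
  simp only [coframeDeriv2, coordDeriv]
  split_ifs <;> rfl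

theorem hasDerivAt_single {v : ℝ → ℝ} {v' s : ℝ} (hv : HasDerivAt v v' s) (i j k l : Fin 4) :
    HasDerivAt (fun t => (Matrix.single i j (v t) : Mat) k l)
      ((Matrix.single i j v' : Mat) k l) s := by
  by_cases h : i = k ∧ j = l
  · simpa [Matrix.single, h] using hv
  · simpa [Matrix.single, h] using hasDerivAt_const s (0 : ℝ)

theorem hasDerivAt_sin_sq (t : ℝ) :
    HasDerivAt (fun t => Real.sin t ^ 2) (2 * Real.sin t * Real.cos t) t :=
  ((Real.hasDerivAt_sin t).pow 2).congr_deriv (by simp)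

theorem hasDerivAt_sin_mul_cos (t : ℝ) :
    HasDerivAt (fun t => Real.sin t * Real.cos t) (Real.cos t ^ 2 - Real.sin t ^ 2) t :=
  ((Real.hasDerivAt_sin t).mul (Real.hasDerivAt_cos t)).congr_deriv (by ring)

theorem hasPd_coframe (a : ℝ) (x : Pt) (c : Fin 4) :
    HasPd c (fun y => coframe a (y 1) (y 2)) (coframeDeriv a c (x 1) (x 2)) x := by
  have h1 : HasDerivAt (fun r : ℝ => -(r ^ 2 + a ^ 2)) (-(2 * x 1)) (x 1) :=
    ((hasDerivAt_pow 2 (x 1)).add_const (a ^ 2)).neg.congr_deriv (by simp)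
  have h2 := ((hasDerivAt_sin_sq (x 2)).const_mul a).neg
  refine hasPd_of_coords (fun j k => ?_) (fun j k => ?_) c
  · fin_cases j <;> fin_cases k <;>
      first
      | exact hasDerivAt_const _ _
      | exact h1
  · fin_cases j <;> fin_cases k <;>
      first
      | exact hasDerivAt_const _ _
      | exact h2

theorem hasPd_coframeDeriv (a : ℝ) (x : Pt) (c d : Fin 4) :
    HasPd c (fun y => coframeDeriv a d (y 1) (y 2)) (coframeDeriv2 a c d (x 2)) x := by
  have h1 : HasDerivAt (fun r : ℝ => -(2 * r)) (-2) (x 1) :=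
    ((hasDerivAt_id (x 1)).const_mul 2).neg.congr_deriv (by simp)
  have h2 : HasDerivAt (fun t : ℝ => -(a * (2 * Real.sin t * Real.cos t)))
      (-(2 * a * (Real.cos (x 2) ^ 2 - Real.sin (x 2) ^ 2))) (x 2) :=
    (((hasDerivAt_sin_mul_cos (x 2)).const_mul (2 * a)).neg).congr_of_eventuallyEq
      (Filter.Eventually.of_forall fun t => by simp; ring)
  refine hasPd_of_coords (fun j k => ?_) (fun j k => ?_) c
  · fin_cases d
    · exact hasDerivAt_const _ _
    · exact hasDerivAt_single h1 3 3 j k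
    · exact hasDerivAt_const _ _
    · exact hasDerivAt_const _ _
  · fin_cases d
    · exact hasDerivAt_const _ _
    · exact hasDerivAt_const _ _
    · exact hasDerivAt_single h2 0 3 j k
    · exact hasDerivAt_const _ _

/-- `Σ` as a function of `r` and `θ`. -/
def sg (a r t : ℝ) : ℝ := r ^ 2 + a ^ 2 * Real.cos t ^ 2

/-- `Δ_r` for the function `N = 2 r M(r)`. -/
def dl (a : ℝ) (N : ℝ → ℝ) (r : ℝ) : ℝ := r ^ 2 + a ^ 2 - N r

/-- The coefficient `N'/(2Σ) - r N/Σ²` of the connection. -/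
def cn (a : ℝ) (N N' : ℝ → ℝ) (r t : ℝ) : ℝ := N' r / (2 * sg a r t) - r * N r / sg a r t ^ 2

/-- The coefficient `-a sin θ cos θ N/Σ²` of the connection. -/
def cv (a : ℝ) (N : ℝ → ℝ) (r t : ℝ) : ℝ :=
  -(a * (Real.sin t * Real.cos t) * N r / sg a r t ^ 2)

/-! ### Derivatives of the coefficients of the connection -/

section derivatives

variable {a r t : ℝ} {N N' N'' : ℝ → ℝ}

theorem hasDerivAt_sg_r (a r t : ℝ) : HasDerivAt (fun r => sg a r t) (2 * r) r :=
  ((hasDerivAt_pow 2 r).add_const _).congr_deriv (by simp)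

theorem hasDerivAt_sg_t (a r t : ℝ) :
    HasDerivAt (fun t => sg a r t) (-(2 * a ^ 2 * (Real.sin t * Real.cos t))) t :=
  ((((Real.hasDerivAt_cos t).pow 2).const_mul (a ^ 2)).const_add (r ^ 2)).congr_deriv
    (by simp; ring)

theorem hasDerivAt_dl (hN : HasDerivAt N (N' r) r) :
    HasDerivAt (dl a N) (2 * r - N' r) r :=
  (((hasDerivAt_pow 2 r).add_const (a ^ 2)).sub hN).congr_deriv (by simp)

theorem hasDerivAt_cn_r (hS : sg a r t ≠ 0) (hN : HasDerivAt N (N' r) r)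
    (hN' : HasDerivAt N' (N'' r) r) :
    HasDerivAt (fun r => cn a N N' r t) (N'' r / (2 * sg a r t) - 2 * r * N' r / sg a r t ^ 2
      - N r / sg a r t ^ 2 + 4 * r ^ 2 * N r / sg a r t ^ 3) r := by
  have h := hasDerivAt_sg_r a r t
  refine ((hN'.div (h.const_mul 2) (mul_ne_zero two_ne_zero hS)).sub
    (((hasDerivAt_id r).mul hN).div (h.pow 2) (pow_ne_zero 2 hS))).congr_deriv ?_
  simp
  field_simp
  ring

theorem hasDerivAt_cn_t (hS : sg a r t ≠ 0) :
    HasDerivAt (fun t => cn a N N' r t) (a ^ 2 * (Real.sin t * Real.cos t) * N' r / sg a r t ^ 2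
      - 4 * a ^ 2 * (Real.sin t * Real.cos t) * r * N r / sg a r t ^ 3) t := by
  have h := hasDerivAt_sg_t a r t
  refine (((hasDerivAt_const t (N' r)).div (h.const_mul 2) (mul_ne_zero two_ne_zero hS)).sub
    ((hasDerivAt_const t (r * N r)).div (h.pow 2) (pow_ne_zero 2 hS))).congr_deriv ?_
  simp
  field_simp
  ring

/-- The `r`-derivative of `f(r)/Σ`. -/
theorem hasDerivAt_div_sg_r {f : ℝ → ℝ} {f' : ℝ} (hS : sg a r t ≠ 0) (hf : HasDerivAt f f' r) :
    HasDerivAt (fun r => f r / sg a r t) (f' / sg a r t - 2 * r * f r / sg a r t ^ 2) r := by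
  refine (hf.div (hasDerivAt_sg_r a r t) hS).congr_deriv ?_
  field_simp

/-- The `r`-derivative of `f(r)/Σ²`. -/
theorem hasDerivAt_div_sg_sq_r {f : ℝ → ℝ} {f' : ℝ} (hS : sg a r t ≠ 0)
    (hf : HasDerivAt f f' r) :
    HasDerivAt (fun r => f r / sg a r t ^ 2)
      (f' / sg a r t ^ 2 - 4 * r * f r / sg a r t ^ 3) r := by
  refine (hf.div ((hasDerivAt_sg_r a r t).pow 2) (pow_ne_zero _ hS)).congr_deriv ?_
  simp
  field_simp
  ring

/-- The `θ`-derivative of `f(θ)/Σ`. -/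
theorem hasDerivAt_div_sg_t {f : ℝ → ℝ} {f' : ℝ} (hS : sg a r t ≠ 0) (hf : HasDerivAt f f' t) :
    HasDerivAt (fun t => f t / sg a r t) (f' / sg a r t
      + 2 * a ^ 2 * (Real.sin t * Real.cos t) * f t / sg a r t ^ 2) t := by
  refine (hf.div (hasDerivAt_sg_t a r t) hS).congr_deriv ?_
  field_simp
  ring

/-- The `θ`-derivative of `f(θ)/Σ²`. -/
theorem hasDerivAt_div_sg_sq_t {f : ℝ → ℝ} {f' : ℝ} (hS : sg a r t ≠ 0)
    (hf : HasDerivAt f f' t) :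
    HasDerivAt (fun t => f t / sg a r t ^ 2) (f' / sg a r t ^ 2
      + 4 * a ^ 2 * (Real.sin t * Real.cos t) * f t / sg a r t ^ 3) t := by
  refine (hf.div ((hasDerivAt_sg_t a r t).pow 2) (pow_ne_zero _ hS)).congr_deriv ?_
  simp
  field_simp
  ring

theorem hasDerivAt_cv_r (hS : sg a r t ≠ 0) (hN : HasDerivAt N (N' r) r) :
    HasDerivAt (fun r => cv a N r t) (-(a * (Real.sin t * Real.cos t)
      * (N' r / sg a r t ^ 2 - 4 * r * N r / sg a r t ^ 3))) r := by
  refine (hasDerivAt_div_sg_sq_r hS (hN.const_mul (a * (Real.sin t * Real.cos t)))).neg.congr_deriv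
    ?_
  field_simp

theorem hasDerivAt_cv_t (hS : sg a r t ≠ 0) :
    HasDerivAt (fun t => cv a N r t) (-(a * N r * ((Real.cos t ^ 2 - Real.sin t ^ 2) / sg a r t ^ 2
      + 4 * a ^ 2 * (Real.sin t * Real.cos t) ^ 2 / sg a r t ^ 3))) t := by
  refine (hasDerivAt_div_sg_sq_t hS
    (((hasDerivAt_sin_mul_cos t).const_mul a).mul_const (N r))).neg.congr_deriv ?_
  field_simp

end derivatives

/-- The connection matrices, with indices lowered, of the Kerr-like metric in the coframe. -/
def conn (a : ℝ) (N N' : ℝ → ℝ) (c : Fin 4) (r t : ℝ) : Mat :=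
  match c with
  | 0 => connMat 0 ![cn a N N' r t, 0, 0, 0, 0, cv a N r t]
  | 1 => connMat
      ![-((2 * r - N' r) / 2 / sg a r t) + r * dl a N r / sg a r t ^ 2,
        r / dl a N r - sg a r t * ((2 * r - N' r) / 2) / dl a N r ^ 2, r,
        -(r * Real.sin t ^ 2 / sg a r t ^ 2)]
      ![0, 0, -(a * r * Real.sin t ^ 2 / sg a r t ^ 2),
        -(a ^ 2 * (Real.sin t * Real.cos t) / dl a N r), 0, 0]
  | 2 => connMat
      ![-(a ^ 2 * (Real.sin t * Real.cos t) * dl a N r / sg a r t ^ 2),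
        -(a ^ 2 * (Real.sin t * Real.cos t) / dl a N r), -(a ^ 2 * (Real.sin t * Real.cos t)),
        Real.sin t * Real.cos t * (r ^ 2 + a ^ 2) / sg a r t ^ 2]
      ![0, 0, a * (Real.sin t * Real.cos t) * dl a N r / sg a r t ^ 2, -r, 0, 0]
  | 3 => connMat 0
      ![a * Real.sin t ^ 2 * (r / sg a r t - cn a N N' r t),
        a * (Real.sin t * Real.cos t) * dl a N r / sg a r t, 0, 0, r * Real.sin t ^ 2 / sg a r t,
        Real.sin t * Real.cos t * (r ^ 2 + a ^ 2) / sg a r t - a * Real.sin t ^ 2 * cv a N r t]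

/-- The `r`-derivatives of the connection matrices. -/
def connDr (a : ℝ) (N N' N'' : ℝ → ℝ) (c : Fin 4) (r t : ℝ) : Mat :=
  let S := sg a r t
  let D := dl a N r
  let D' := 2 * r - N' r
  let sc := Real.sin t * Real.cos t
  let s2 := Real.sin t ^ 2
  let nr := N'' r / (2 * S) - 2 * r * N' r / S ^ 2 - N r / S ^ 2 + 4 * r ^ 2 * N r / S ^ 3
  let vr := -(a * sc * (N' r / S ^ 2 - 4 * r * N r / S ^ 3))
  match c with
  | 0 => connMat 0 ![nr, 0, 0, 0, 0, vr]
  | 1 => connMat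
      ![-((2 - N'' r) / 2 / S - 2 * r * (D' / 2) / S ^ 2) + ((D + r * D') / S ^ 2
          - 4 * r * (r * D) / S ^ 3),
        (D - r * D') / D ^ 2 - ((2 * r * (D' / 2) + S * ((2 - N'' r) / 2)) / D ^ 2
          - 2 * S * (D' / 2) * D' / D ^ 3), 1,
        -(s2 / S ^ 2 - 4 * r * (r * s2) / S ^ 3)]
      ![0, 0, -(a * s2 / S ^ 2 - 4 * r * (a * r * s2) / S ^ 3), a ^ 2 * sc * D' / D ^ 2, 0, 0]
  | 2 => connMat
      ![-(a ^ 2 * sc * D' / S ^ 2 - 4 * r * (a ^ 2 * sc * D) / S ^ 3), a ^ 2 * sc * D' / D ^ 2, 0,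
        sc * (2 * r) / S ^ 2 - 4 * r * (sc * (r ^ 2 + a ^ 2)) / S ^ 3]
      ![0, 0, a * sc * D' / S ^ 2 - 4 * r * (a * sc * D) / S ^ 3, -1, 0, 0]
  | 3 => connMat 0
      ![a * s2 * (1 / S - 2 * r * r / S ^ 2 - nr), a * sc * D' / S - 2 * r * (a * sc * D) / S ^ 2,
        0, 0, s2 / S - 2 * r * (r * s2) / S ^ 2,
        sc * (2 * r) / S - 2 * r * (sc * (r ^ 2 + a ^ 2)) / S ^ 2 - a * s2 * vr]

/-- The `θ`-derivatives of the connection matrices. -/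
def connDt (a : ℝ) (N N' : ℝ → ℝ) (c : Fin 4) (r t : ℝ) : Mat :=
  let S := sg a r t
  let D := dl a N r
  let D' := 2 * r - N' r
  let K := r ^ 2 + a ^ 2
  let sc := Real.sin t * Real.cos t
  let s2 := Real.sin t ^ 2
  let c2 := Real.cos t ^ 2 - Real.sin t ^ 2
  let nt := a ^ 2 * sc * N' r / S ^ 2 - 4 * a ^ 2 * sc * r * N r / S ^ 3
  let vt := -(a * N r * (c2 / S ^ 2 + 4 * a ^ 2 * sc ^ 2 / S ^ 3))
  match c with
  | 0 => connMat 0 ![nt, 0, 0, 0, 0, vt]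
  | 1 => connMat
      ![-(0 / S + 2 * a ^ 2 * sc * (D' / 2) / S ^ 2) + (0 / S ^ 2
          + 4 * a ^ 2 * sc * (r * D) / S ^ 3),
        a ^ 2 * sc * D' / D ^ 2, 0,
        -(r * (2 * Real.sin t * Real.cos t) / S ^ 2 + 4 * a ^ 2 * sc * (r * s2) / S ^ 3)]
      ![0, 0, -(a * r * (2 * Real.sin t * Real.cos t) / S ^ 2
          + 4 * a ^ 2 * sc * (a * r * s2) / S ^ 3), -(a ^ 2 * c2 / D), 0, 0]
  | 2 => connMat
      ![-(a ^ 2 * c2 * D / S ^ 2 + 4 * a ^ 2 * sc * (a ^ 2 * sc * D) / S ^ 3), -(a ^ 2 * c2 / D),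
        -(a ^ 2 * c2), c2 * K / S ^ 2 + 4 * a ^ 2 * sc * (sc * K) / S ^ 3]
      ![0, 0, a * c2 * D / S ^ 2 + 4 * a ^ 2 * sc * (a * sc * D) / S ^ 3, 0, 0, 0]
  | 3 => connMat 0
      ![a * (2 * Real.sin t * Real.cos t) * (r / S - cn a N N' r t)
          + a * s2 * ((0 / S + 2 * a ^ 2 * sc * r / S ^ 2) - nt),
        a * c2 * D / S + 2 * a ^ 2 * sc * (a * sc * D) / S ^ 2, 0, 0,
        r * (2 * Real.sin t * Real.cos t) / S + 2 * a ^ 2 * sc * (r * s2) / S ^ 2,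
        (c2 * K / S + 2 * a ^ 2 * sc * (sc * K) / S ^ 2)
          - (a * (2 * Real.sin t * Real.cos t) * cv a N r t + a * s2 * vt)]

theorem hasDerivAt_conn_r {a r t : ℝ} {N N' N'' : ℝ → ℝ} (hS : sg a r t ≠ 0) (hD : dl a N r ≠ 0)
    (hN : HasDerivAt N (N' r) r) (hN' : HasDerivAt N' (N'' r) r) (c j k : Fin 4) :
    HasDerivAt (fun r => conn a N N' c r t j k) (connDr a N N' N'' c r t j k) r := by
  have h0 : HasDerivAt (fun _ : ℝ => (0 : ℝ)) 0 r := hasDerivAt_const _ _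
  have hid := hasDerivAt_id r
  have hdl := hasDerivAt_dl (a := a) hN
  have hK : HasDerivAt (fun r => r ^ 2 + a ^ 2) (2 * r) r :=
    ((hasDerivAt_pow 2 r).add_const (a ^ 2)).congr_deriv (by simp)
  have hD' : HasDerivAt (fun r => (2 * r - N' r) / 2) ((2 - N'' r) / 2) r :=
    (((hid.const_mul 2).sub hN').div_const 2).congr_deriv (by simp)
  have hn := hasDerivAt_cn_r hS hN hN'
  have hv := hasDerivAt_cv_r hS hN
  have hinv : HasDerivAt (fun r => -(a ^ 2 * (Real.sin t * Real.cos t) / dl a N r))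
      (a ^ 2 * (Real.sin t * Real.cos t) * (2 * r - N' r) / dl a N r ^ 2) r :=
    ((hasDerivAt_const r (a ^ 2 * (Real.sin t * Real.cos t))).div hdl hD).neg.congr_deriv
      (by simp; ring)
  match c with
  | 0 =>
    refine hasDerivAt_connMat (fun i => h0) (fun i => ?_) j k
    fin_cases i
    exacts [hn, h0, h0, h0, h0, hv]
  | 1 =>
    refine hasDerivAt_connMat (fun i => ?_) (fun i => ?_) j k
    · fin_cases i
      · exact ((hasDerivAt_div_sg_r hS hD').neg.add (hasDerivAt_div_sg_sq_r hS
          (hid.mul hdl))).congr_deriv (by simp)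
      · refine ((hid.div hdl hD).sub (((hasDerivAt_sg_r a r t).mul hD').div (hdl.pow 2)
          (pow_ne_zero 2 hD))).congr_deriv ?_
        simp
        field_simp
      · exact hid
      · exact (hasDerivAt_div_sg_sq_r hS (hid.mul_const _)).neg.congr_deriv (by simp)
    · fin_cases i
      · exact h0
      · exact h0
      · exact (hasDerivAt_div_sg_sq_r hS ((hid.const_mul a).mul_const _)).neg.congr_deriv (by simp)
      · exact hinv
      · exact h0
      · exact h0
  | 2 =>
    refine hasDerivAt_connMat (fun i => ?_) (fun i => ?_) j k
    · fin_cases i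
      · exact (hasDerivAt_div_sg_sq_r hS (hdl.const_mul _)).neg
      · exact hinv
      · exact hasDerivAt_const _ _
      · exact hasDerivAt_div_sg_sq_r hS (hK.const_mul _)
    · fin_cases i
      · exact h0
      · exact h0
      · exact hasDerivAt_div_sg_sq_r hS (hdl.const_mul _)
      · exact hid.neg
      · exact h0
      · exact h0
  | 3 =>
    refine hasDerivAt_connMat (fun i => h0) (fun i => ?_) j k
    fin_cases i
    · exact ((hasDerivAt_div_sg_r hS hid).sub hn).const_mul _
    · exact hasDerivAt_div_sg_r hS (hdl.const_mul _)
    · exact h0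
    · exact h0
    · exact (hasDerivAt_div_sg_r hS (hid.mul_const _)).congr_deriv (by simp)
    · exact (hasDerivAt_div_sg_r hS (hK.const_mul _)).sub (hv.const_mul _)

theorem hasDerivAt_conn_t {a r t : ℝ} {N N' : ℝ → ℝ} (hS : sg a r t ≠ 0) (hD : dl a N r ≠ 0)
    (c j k : Fin 4) :
    HasDerivAt (fun t => conn a N N' c r t j k) (connDt a N N' c r t j k) t := by
  have h0 : HasDerivAt (fun _ : ℝ => (0 : ℝ)) 0 t := hasDerivAt_const _ _
  have hc : ∀ b : ℝ, HasDerivAt (fun _ : ℝ => b) 0 t := fun b => hasDerivAt_const _ _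
  have hsc := hasDerivAt_sin_mul_cos t
  have hs2 := hasDerivAt_sin_sq t
  have hn := hasDerivAt_cn_t (N := N) (N' := N') hS
  have hv := hasDerivAt_cv_t (N := N) hS
  match c with
  | 0 =>
    refine hasDerivAt_connMat (fun i => h0) (fun i => ?_) j k
    fin_cases i
    exacts [hn, h0, h0, h0, h0, hv]
  | 1 =>
    refine hasDerivAt_connMat (fun i => ?_) (fun i => ?_) j k
    · fin_cases i
      · exact (hasDerivAt_div_sg_t hS (hc _)).neg.add (hasDerivAt_div_sg_sq_t hS (hc _))
      · refine ((hc (r / dl a N r)).sub (((hasDerivAt_sg_t a r t).mul_const _).div_const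
          _)).congr_deriv ?_
        simp
        field_simp
      · exact hc r
      · exact (hasDerivAt_div_sg_sq_t hS (hs2.const_mul r)).neg
    · fin_cases i
      · exact h0
      · exact h0
      · exact (hasDerivAt_div_sg_sq_t hS (hs2.const_mul _)).neg
      · exact ((hsc.const_mul _).div_const _).neg
      · exact h0
      · exact h0
  | 2 =>
    refine hasDerivAt_connMat (fun i => ?_) (fun i => ?_) j k
    · fin_cases i
      · exact (hasDerivAt_div_sg_sq_t hS ((hsc.const_mul _).mul_const _)).neg
      · exact ((hsc.const_mul _).div_const _).neg
      · exact (hsc.const_mul _).neg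
      · exact hasDerivAt_div_sg_sq_t hS (hsc.mul_const _)
    · fin_cases i
      · exact h0
      · exact h0
      · exact hasDerivAt_div_sg_sq_t hS ((hsc.const_mul _).mul_const _)
      · exact hc _
      · exact h0
      · exact h0
  | 3 =>
    refine hasDerivAt_connMat (fun i => h0) (fun i => ?_) j k
    fin_cases i
    · exact (hs2.const_mul a).mul ((hasDerivAt_div_sg_t hS (hc r)).sub hn)
    · exact hasDerivAt_div_sg_t hS ((hsc.const_mul _).mul_const _)
    · exact h0
    · exact h0
    · exact hasDerivAt_div_sg_t hS (hs2.const_mul _)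
    · exact (hasDerivAt_div_sg_t hS (hsc.mul_const _)).sub ((hs2.const_mul a).mul hv)

theorem connMat_add_transpose (d : Fin 4 → ℝ) (w : Fin 6 → ℝ) :
    connMat d w + (connMat d w)ᵀ = Matrix.diagonal (fun i => 2 * d i) := by
  ext i j
  fin_cases i <;> fin_cases j <;> simp [connMat, two_mul, Matrix.diagonal]

/-- The metric in the coframe. -/
def frameMetric (a : ℝ) (N : ℝ → ℝ) (r t : ℝ) : Mat :=
  Matrix.diagonal (diagCoeff (sg a r t) (dl a N r) (Real.sin t))

/-- Metric compatibility: the skew part of the connection drops out of the sum with the transpose,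
and its diagonal entries are half the derivatives of the metric coefficients. -/
theorem hasPd_frameMetric {a : ℝ} {N N' : ℝ → ℝ} {x : Pt} (hS : sg a (x 1) (x 2) ≠ 0)
    (hD : dl a N (x 1) ≠ 0) (hN : HasDerivAt N (N' (x 1)) (x 1)) (c : Fin 4) :
    HasPd c (fun y => frameMetric a N (y 1) (y 2))
      (conn a N N' c (x 1) (x 2) + (conn a N N' c (x 1) (x 2))ᵀ) x := by
  have hdl := hasDerivAt_dl (a := a) hN
  have key := hasPd_of_coords (A := frameMetric a N)
    (Ar := conn a N N' 1 (x 1) (x 2) + (conn a N N' 1 (x 1) (x 2))ᵀ)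
    (At := conn a N N' 2 (x 1) (x 2) + (conn a N N' 2 (x 1) (x 2))ᵀ) (x := x) ?_ ?_ c
  · convert key using 1
    fin_cases c
    · change connMat _ _ + (connMat _ _)ᵀ = 0
      rw [connMat_add_transpose]
      ext i j
      simp
    · rfl
    · rfl
    · change connMat _ _ + (connMat _ _)ᵀ = 0
      rw [connMat_add_transpose]
      ext i j
      simp
  · intro j k
    simp only [conn, connMat_add_transpose]
    refine hasDerivAt_diagonal (fun i => ?_) j k
    fin_cases i
    · refine (hasDerivAt_div_sg_r hS hdl).neg.congr_deriv ?_
      simp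
      field_simp
      ring
    · refine ((hasDerivAt_sg_r a (x 1) (x 2)).div hdl hD).congr_deriv ?_
      simp
      field_simp
    · exact hasDerivAt_sg_r a (x 1) (x 2)
    · refine (hasDerivAt_div_sg_r hS (hasDerivAt_const _ _)).congr_deriv ?_
      simp
      field_simp
  · intro j k
    simp only [conn, connMat_add_transpose]
    refine hasDerivAt_diagonal (fun i => ?_) j k
    fin_cases i
    · refine (hasDerivAt_div_sg_t hS (hasDerivAt_const _ _)).neg.congr_deriv ?_
      simp
      field_simp
    · refine ((hasDerivAt_sg_t a (x 1) (x 2)).div_const _).congr_deriv ?_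
      simp
      field_simp
    · exact (hasDerivAt_sg_t a (x 1) (x 2)).congr_deriv (by simp; ring)
    · refine (hasDerivAt_div_sg_t hS (hasDerivAt_sin_sq (x 2))).congr_deriv ?_
      simp
      field_simp
      rw [sg, Real.cos_sq']
      ring

/-- The first structure equation. Together with metric compatibility it characterises the
Levi-Civita connection. -/
theorem coframe_torsionFree {a r t : ℝ} {N N' : ℝ → ℝ} (hS : sg a r t ≠ 0) (hD : dl a N r ≠ 0)
    (i b c : Fin 4) :
    (frameMetric a N r t * coframeDeriv a c r t + conn a N N' c r t * coframe a r t) i b =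
      (frameMetric a N r t * coframeDeriv a b r t + conn a N N' b r t * coframe a r t) i c := by
  wlog hbc : b < c generalizing b c
  · rcases eq_or_lt_of_le (not_lt.mp hbc) with h | h
    · rw [h]
    · exact (this c b h).symm
  have hc : Real.cos t ^ 2 = 1 - Real.sin t ^ 2 := Real.cos_sq' t
  have e : ∀ (M : Mat) (i b), (frameMetric a N r t * M) i b
      = diagCoeff (sg a r t) (dl a N r) (Real.sin t) i * M i b := by
    intro M i b
    simp [frameMetric, Matrix.diagonal_mul]
  simp only [Matrix.add_apply, e, Matrix.mul_apply, Fin.sum_univ_four]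
  fin_cases b <;> fin_cases c <;> first | (exact absurd hbc (by decide)) | skip
  all_goals
    fin_cases i <;>
      simp [coframeDeriv, coordDeriv, conn, connMat, coframe, diagCoeff, Matrix.single, cn, cv] <;>
      field_simp <;> simp only [sg, dl, hc] <;> ring

/-! ### The curvature two-forms -/

/-- The real part of `Ψ₂`. -/
def psiRe (a : ℝ) (N N' N'' : ℝ → ℝ) (r t : ℝ) : ℝ :=
  -(12 * (r ^ 2 - a ^ 2 * Real.cos t ^ 2) * N r - 6 * sg a r t * r * N' r
    + sg a r t ^ 2 * N'' r) / (12 * sg a r t ^ 3)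

/-- The imaginary part of `Ψ₂`. -/
def psiIm (a : ℝ) (N N' : ℝ → ℝ) (r t : ℝ) : ℝ :=
  a * Real.cos t * (sg a r t * N' r - 4 * r * N r) / (2 * sg a r t ^ 3)

/-- The eigenvalue of the Ricci tensor on the planes spanned by `∂_θ` and its partner. -/
def ricciAng (a : ℝ) (N N' : ℝ → ℝ) (r t : ℝ) : ℝ := (r * N' r - N r) / sg a r t ^ 2

/-- The curvature two-forms of the Kerr-like metric in the coframe. -/
def curvForm (a : ℝ) (N N' N'' : ℝ → ℝ) (r t : ℝ) (c d : Fin 4) : Fin 6 → ℝ :=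
  let S := sg a r t
  let D := dl a N r
  let s := Real.sin t
  let p := psiRe a N N' N'' r t
  let q := psiIm a N N' r t
  let l := ricciAng a N N' r t
  let B := fun i j => bivec (coframe a r t i) (coframe a r t j) c d
  ![-(-2 * p + (N'' r / (3 * S) - l)) * B 0 1 + 2 * q * s * B 2 3,
    (p + N'' r / (12 * S)) * -D * B 0 2 + q * s * B 1 3,
    (p + N'' r / (12 * S)) * -(D * s ^ 2 / S ^ 2) * B 0 3 - q * s * B 1 2,
    (p + N'' r / (12 * S)) * (S ^ 2 / D) * B 1 2 - q * s * B 0 3,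
    (p + N'' r / (12 * S)) * (s ^ 2 / D) * B 1 3 + q * s * B 0 2,
    (-2 * p + (l - N'' r / (6 * S))) * s ^ 2 * B 2 3 + 2 * q * s * B 0 1]

theorem diagonal_diagCoeff_inv {S D s : ℝ} (hS : S ≠ 0) (hD : D ≠ 0) (hs : s ≠ 0) :
    (Matrix.diagonal (diagCoeff S D s))⁻¹ =
      Matrix.diagonal ![-(S / D), D / S, 1 / S, S / s ^ 2] := by
  refine Matrix.inv_eq_right_inv ?_
  rw [Matrix.diagonal_mul_diagonal, ← Matrix.diagonal_one]
  congr 1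
  funext i
  fin_cases i <;> simp [diagCoeff] <;> field_simp

theorem quadSkew_swap (k : Fin 4 → ℝ) (A B : Mat) : quadSkew k B A = -quadSkew k A B := by
  funext i
  fin_cases i <;> simp [quadSkew, Fin.sum_univ_four] <;> ring

theorem connMat_neg (d : Fin 4 → ℝ) (w : Fin 6 → ℝ) : -connMat d w = connMat (-d) (-w) := by
  ext i j
  fin_cases i <;> fin_cases j <;> simp [connMat]

theorem connMat_zero : connMat 0 0 = 0 := by
  ext i j
  fin_cases i <;> fin_cases j <;> simp [connMat]

theorem curvForm_swap (a : ℝ) (N N' N'' : ℝ → ℝ) (r t : ℝ) (c d : Fin 4) :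
    curvForm a N N' N'' r t d c = -curvForm a N N' N'' r t c d := by
  have h : ∀ u v : Fin 4 → ℝ, bivec u v d c = -bivec u v c d := fun u v => by
    simp only [bivec]
    ring
  funext i
  simp only [curvForm, h]
  fin_cases i <;> simp <;> ring

set_option maxHeartbeats 4000000 in
/-- The second structure equation for the Kerr-like metric. -/
theorem curvature_eq {a r t : ℝ} {N N' N'' : ℝ → ℝ} (hS : sg a r t ≠ 0) (hD : dl a N r ≠ 0)
    (hs : Real.sin t ≠ 0) (c d : Fin 4) :
    coordDeriv (connDr a N N' N'' d r t) (connDt a N N' d r t) c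
      - coordDeriv (connDr a N N' N'' c r t) (connDt a N N' c r t) d
      - connMat 0 (quadSkew ![-(sg a r t / dl a N r), dl a N r / sg a r t, 1 / sg a r t,
          sg a r t / Real.sin t ^ 2] (conn a N N' c r t) (conn a N N' d r t))
      = connMat 0 (curvForm a N N' N'' r t c d) := by
  -- Both sides are antisymmetric in c, d, which leaves six pairs of indices to compute.
  wlog hcd : c < d generalizing c d
  · rcases eq_or_lt_of_le (not_lt.mp hcd) with h | h
    · subst h
      have h1 : ∀ w : Fin 6 → ℝ, w = -w → w = 0 := fun w hw => by
        funext i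
        have := congrFun hw i
        simp only [Pi.neg_apply] at this
        simp only [Pi.zero_apply]
        linarith
      rw [h1 _ (quadSkew_swap _ _ _), h1 _ (curvForm_swap a N N' N'' r t d d), sub_self,
        connMat_zero, sub_self]
    · have h2 := this d c h
      rw [quadSkew_swap, curvForm_swap, ← neg_zero, ← connMat_neg, ← connMat_neg, ← h2]
      abel
  -- Even powers of cos θ are eliminated in favour of sin θ, so that `ring` can decide identities
  -- modulo sin² + cos² = 1.
  have hc2 : Real.cos t ^ 2 = 1 - Real.sin t ^ 2 := Real.cos_sq' t
  have hc3 : Real.cos t ^ 3 = Real.cos t * (1 - Real.sin t ^ 2) := by rw [← hc2]; ring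
  have hc4 : Real.cos t ^ 4 = (1 - Real.sin t ^ 2) ^ 2 := by rw [← hc2]; ring
  have hc5 : Real.cos t ^ 5 = Real.cos t * (1 - Real.sin t ^ 2) ^ 2 := by rw [← hc2]; ring
  have hc6 : Real.cos t ^ 6 = (1 - Real.sin t ^ 2) ^ 3 := by rw [← hc2]; ring
  fin_cases c <;> fin_cases d <;> first | (exact absurd hcd (by decide)) | skip
  all_goals
    simp only [Fin.zero_eta, Fin.mk_one, Fin.reduceFinMk, coordDeriv_zero, coordDeriv_one,
      coordDeriv_two, coordDeriv_three]
    simp only [← connMat_zero, connDr, connDt, connMat_sub]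
    congr 1
    -- The diagonal part of the connection is half a gradient, that of the metric coefficients, so
    -- its curl vanishes.
    · funext i
      fin_cases i <;> simp <;> field_simp <;> simp only [sg, hc2] <;> ring
    · funext i
      simp only [curvForm, quadSkew, bivec, conn, connMat, Fin.sum_univ_four, coframe]
      fin_cases i <;> simp [cn, cv, psiRe, psiIm, ricciAng]
      all_goals
        field_simp
        simp only [sg, dl]
        ring_nf
        try simp only [hc2, hc3, hc4, hc5, hc6]
        try ring

/-! ### The Weyl tensor of the Kerr-like metric -/

/-- The function `N = 2 r M(r)`. -/
def massN (M : ℝ → ℝ) (r : ℝ) : ℝ := 2 * M r * r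

/-- The first derivative of `N = 2 r M(r)`. -/
def massN' (M : ℝ → ℝ) (r : ℝ) : ℝ := 2 * M r + 2 * r * deriv M r

/-- The second derivative of `N = 2 r M(r)`. -/
def massN'' (M : ℝ → ℝ) (r : ℝ) : ℝ := 4 * deriv M r + 2 * r * deriv (deriv M) r

section mass

variable {M : ℝ → ℝ} {I : Set ℝ} {r : ℝ}

theorem hasDerivAt_mass (hI : IsOpen I) (hM : ContDiffOn ℝ 3 M I) (hr : r ∈ I) :
    HasDerivAt M (deriv M r) r :=
  ((hM.differentiableOn (by norm_num)).differentiableAt (hI.mem_nhds hr)).hasDerivAt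

theorem contDiffOn_deriv_mass (hI : IsOpen I) (hM : ContDiffOn ℝ 3 M I) :
    ContDiffOn ℝ 2 (deriv M) I :=
  hM.deriv_of_isOpen hI (by norm_num)

theorem contDiffOn_deriv_deriv_mass (hI : IsOpen I) (hM : ContDiffOn ℝ 3 M I) :
    ContDiffOn ℝ 1 (deriv (deriv M)) I :=
  (contDiffOn_deriv_mass hI hM).deriv_of_isOpen hI (by norm_num)

theorem hasDerivAt_deriv_mass (hI : IsOpen I) (hM : ContDiffOn ℝ 3 M I) (hr : r ∈ I) :
    HasDerivAt (deriv M) (deriv (deriv M) r) r :=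
  (((contDiffOn_deriv_mass hI hM).differentiableOn (by norm_num)).differentiableAt
    (hI.mem_nhds hr)).hasDerivAt

theorem hasDerivAt_massN (hI : IsOpen I) (hM : ContDiffOn ℝ 3 M I) (hr : r ∈ I) :
    HasDerivAt (massN M) (massN' M r) r :=
  (((hasDerivAt_mass hI hM hr).const_mul 2).mul (hasDerivAt_id r)).congr_deriv
    (by simp [massN']; ring)

theorem hasDerivAt_massN' (hI : IsOpen I) (hM : ContDiffOn ℝ 3 M I) (hr : r ∈ I) :
    HasDerivAt (massN' M) (massN'' M r) r :=
  (((hasDerivAt_mass hI hM hr).const_mul 2).add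
    (((hasDerivAt_id r).const_mul 2).mul (hasDerivAt_deriv_mass hI hM hr))).congr_deriv
    (by simp [massN'']; ring)

theorem isOpen_domain (a : ℝ) (hI : IsOpen I) (hM : ContDiffOn ℝ 3 M I) :
    IsOpen (domain a M I) := by
  have h1 : IsOpen {x : Pt | x 1 ∈ I} := hI.preimage (continuous_apply 1)
  have h2 : ContinuousOn (Del a M) {x : Pt | x 1 ∈ I} := by
    have : ContinuousOn (fun x : Pt => M (x 1)) {x : Pt | x 1 ∈ I} :=
      hM.continuousOn.comp (continuous_apply 1).continuousOn fun x hx => hx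
    have h' : Continuous fun x : Pt => x 1 := continuous_apply 1
    exact ((h'.pow 2).continuousOn.sub ((continuousOn_const.mul this).mul h'.continuousOn)).add
      continuousOn_const
  have h3 : Continuous (Sig a) := by
    unfold Sig
    fun_prop
  have h4 : IsOpen {x : Pt | x 2 ∈ Set.Ioo 0 Real.pi} :=
    isOpen_Ioo.preimage (continuous_apply 2)
  have h5 : IsOpen ({x : Pt | x 1 ∈ I} ∩ Del a M ⁻¹' {0}ᶜ) :=
    h2.isOpen_inter_preimage h1 isOpen_compl_singleton
  have h6 : IsOpen (Sig a ⁻¹' {0}ᶜ) := isOpen_compl_singleton.preimage h3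
  convert (h5.inter h4).inter h6 using 1
  ext x
  simp only [domain, Set.mem_ofPred_eq, Set.mem_inter_iff, Set.mem_preimage, Set.mem_compl_iff,
    Set.mem_singleton_iff]
  tauto

end mass

theorem sig_eq (a : ℝ) (x : Pt) : Sig a x = sg a (x 1) (x 2) := rfl

theorem del_eq (a : ℝ) (M : ℝ → ℝ) (x : Pt) : Del a M x = dl a (massN M) (x 1) := by
  simp only [Del, dl, massN]
  ring

theorem metric_eq (a : ℝ) (M : ℝ → ℝ) (x : Pt) :
    metric a M x = (coframe a (x 1) (x 2))ᵀ * frameMetric a (massN M) (x 1) (x 2)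
      * coframe a (x 1) (x 2) := by
  ext i j
  simp only [metric, frameMetric, Matrix.mul_apply, Matrix.transpose_apply,
    Fin.sum_univ_four, Matrix.of_apply, sig_eq, del_eq]
  fin_cases i <;> fin_cases j <;>
    simp [formT, formR, formTheta, formPhi, coframe, diagCoeff] <;> ring

theorem metric_apply (a : ℝ) (M : ℝ → ℝ) (x : Pt) (i j : Fin 4) :
    metric a M x i j = ∑ k, diagCoeff (sg a (x 1) (x 2)) (dl a (massN M) (x 1)) (Real.sin (x 2)) k
      * (coframe a (x 1) (x 2) k i * coframe a (x 1) (x 2) k j) := by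
  rw [metric_eq, Matrix.mul_apply]
  refine Finset.sum_congr rfl fun k _ => ?_
  rw [frameMetric, Matrix.mul_diagonal, Matrix.transpose_apply]
  ring

theorem det_coframe (a r t : ℝ) : (coframe a r t).det = -sg a r t := by
  have hc : Real.cos t ^ 2 = 1 - Real.sin t ^ 2 := Real.cos_sq' t
  simp [coframe, Matrix.det_succ_row_zero, Fin.sum_univ_succ, Fin.succAbove, sg, hc]
  ring

/-! ### Nondegeneracy, Riemann tensor and Weyl tensor at points of the domain -/

section point

variable {a : ℝ} {M : ℝ → ℝ} {I : Set ℝ} {x : Pt}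

theorem sg_ne_zero (hx : x ∈ domain a M I) : sg a (x 1) (x 2) ≠ 0 := hx.2.2.1

theorem dl_ne_zero (hx : x ∈ domain a M I) : dl a (massN M) (x 1) ≠ 0 := by
  rw [← del_eq]
  exact hx.2.2.2

theorem sin_ne_zero (hx : x ∈ domain a M I) : Real.sin (x 2) ≠ 0 :=
  (Real.sin_pos_of_mem_Ioo hx.2.1).ne'

theorem det_coframe_ne_zero (hx : x ∈ domain a M I) : (coframe a (x 1) (x 2)).det ≠ 0 := by
  rw [det_coframe]
  exact neg_ne_zero.mpr (sg_ne_zero hx)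

theorem det_frameMetric_ne_zero (hx : x ∈ domain a M I) :
    (frameMetric a (massN M) (x 1) (x 2)).det ≠ 0 := by
  have hS := sg_ne_zero hx
  have hD := dl_ne_zero hx
  have hs := sin_ne_zero hx
  rw [frameMetric, Matrix.det_diagonal, Finset.prod_ne_zero_iff]
  intro i _
  fin_cases i <;> simp [diagCoeff, hS, hD, hs]

theorem det_metric_ne_zero (hx : x ∈ domain a M I) : (metric a M x).det ≠ 0 := by
  rw [metric_eq, Matrix.det_mul, Matrix.det_mul, Matrix.det_transpose]
  exact mul_ne_zero (mul_ne_zero (det_coframe_ne_zero hx) (det_frameMetric_ne_zero hx))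
    (det_coframe_ne_zero hx)

theorem riemann_metric (hI : IsOpen I) (hM : ContDiffOn ℝ 3 M I) (hx : x ∈ domain a M I)
    (i j c d : Fin 4) :
    riemann (metric a M) x i j c d = ((coframe a (x 1) (x 2))ᵀ
      * connMat 0 (curvForm a (massN M) (massN' M) (massN'' M) (x 1) (x 2) c d)
      * coframe a (x 1) (x 2)) i j := by
  have hpd : ∀ x ∈ domain a M I, ∀ c d : Fin 4,
      HasPd c (fun y => conn a (massN M) (massN' M) d (y 1) (y 2))
        (coordDeriv (connDr a (massN M) (massN' M) (massN'' M) d (x 1) (x 2))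
          (connDt a (massN M) (massN' M) d (x 1) (x 2)) c) x := fun x hx c d =>
    hasPd_of_coords (hasDerivAt_conn_r (sg_ne_zero hx) (dl_ne_zero hx)
      (hasDerivAt_massN hI hM hx.1) (hasDerivAt_massN' hI hM hx.1) d)
      (hasDerivAt_conn_t (sg_ne_zero hx) (dl_ne_zero hx) d) c
  rw [riemann_eq_of_coframe (isOpen_domain a hI hM) (metric_eq a M)
    (fun x hx => det_coframe_ne_zero hx) (fun x hx => det_frameMetric_ne_zero hx)
    (fun x => Matrix.diagonal_transpose _) (fun x _ c => hasPd_coframe a x c)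
    (dΘ := fun c x => coframeDeriv a c (x 1) (x 2)) (fun x _ c d => hasPd_coframeDeriv a x c d)
    (fun x _ c d => coframeDeriv2_symm a c d (x 2))
    (dh := fun c x => conn a (massN M) (massN' M) c (x 1) (x 2)
      + (conn a (massN M) (massN' M) c (x 1) (x 2))ᵀ)
    (fun x hx c => hasPd_frameMetric (sg_ne_zero hx) (dl_ne_zero hx)
      (hasDerivAt_massN hI hM hx.1) c)
    (α := fun c x => conn a (massN M) (massN' M) c (x 1) (x 2)) hpd (fun x hx c => rfl)
    (fun x hx i b c => coframe_torsionFree (sg_ne_zero hx) (dl_ne_zero hx) i b c) hx i j c d]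
  have hS := sg_ne_zero hx
  have hD := dl_ne_zero hx
  have hs := sin_ne_zero hx
  rw [← curvature_eq hS hD hs, ← connMat_quadratic, frameMetric, diagonal_diagCoeff_inv hS hD hs]
  refine congrFun (congrFun ?_ i) j
  congr 2
  abel

/-- From g = Θᵀ h Θ one gets Θ g⁻¹ Θᵀ = h⁻¹: the inverse metric is diagonal on the coframe too. This
is the input for trace-freeness. -/
theorem trace2_coframe (hx : x ∈ domain a M I) (i j : Fin 4) :
    trace2 (metric a M x)⁻¹ (fun b c => coframe a (x 1) (x 2) i b * coframe a (x 1) (x 2) j c)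
      = if i = j then (diagCoeff (sg a (x 1) (x 2)) (dl a (massN M) (x 1)) (Real.sin (x 2)) i)⁻¹
        else 0 := by
  have hS := sg_ne_zero hx
  have hD := dl_ne_zero hx
  have hs := sin_ne_zero hx
  set Θ := coframe a (x 1) (x 2) with hΘ
  have hu : IsUnit Θ.det := isUnit_iff_ne_zero.mpr (det_coframe_ne_zero hx)
  have h1 : Θ * (metric a M x)⁻¹ * Θᵀ = (frameMetric a (massN M) (x 1) (x 2))⁻¹ := by
    have hT : (Θᵀ)⁻¹ * Θᵀ = 1 := by
      rw [← Matrix.transpose_nonsing_inv, ← Matrix.transpose_mul, Matrix.mul_nonsing_inv _ hu,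
        Matrix.transpose_one]
    rw [metric_eq, ← hΘ, Matrix.mul_inv_rev, Matrix.mul_inv_rev, Matrix.mul_assoc,
      Matrix.mul_assoc, Matrix.mul_assoc, hT, Matrix.mul_one, ← Matrix.mul_assoc,
      Matrix.mul_nonsing_inv _ hu, Matrix.one_mul]
  have h2 : trace2 (metric a M x)⁻¹ (fun b c => Θ i b * Θ j c)
      = (Θ * (metric a M x)⁻¹ * Θᵀ) i j := by
    simp only [trace2, Matrix.mul_apply, Matrix.transpose_apply, Finset.sum_mul]
    rw [Finset.sum_comm]
    exact Finset.sum_congr rfl fun b _ => Finset.sum_congr rfl fun c _ => by ring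
  rw [h2, h1, frameMetric, diagonal_diagCoeff_inv hS hD hs, Matrix.diagonal_apply]
  split_ifs with h
  · fin_cases i <;> simp [diagCoeff, inv_neg]
  · rfl

/-- The Weyl tensor of the Kerr-like metric. -/
theorem weyl_metric (hI : IsOpen I) (hM : ContDiffOn ℝ 3 M I) (hx : x ∈ domain a M I) :
    weyl (metric a M) x = typeDTensor (sg a (x 1) (x 2)) (dl a (massN M) (x 1)) (Real.sin (x 2))
      (psiRe a (massN M) (massN' M) (massN'' M) (x 1) (x 2))
      (psiIm a (massN M) (massN' M) (x 1) (x 2)) (coframe a (x 1) (x 2)) := by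
  have hS := sg_ne_zero hx
  have hD := dl_ne_zero hx
  have hs := sin_ne_zero hx
  have hsymm : ∀ i j, metric a M x i j = metric a M x j i := fun i j => by
    rw [metric_apply, metric_apply]
    exact Finset.sum_congr rfl fun k _ => by ring
  -- P is Ric minus one sixth of the scalar curvature times g. In the coframe Ric has the
  -- eigenvalues N''/(2Σ) - λ on the indices 0, 1 and λ on 2, 3, where λ is `ricciAng`; the scalar
  -- curvature is N''/Σ, so N''/(6Σ) is subtracted from each.
  refine weyl_eq_of_decomposition (det_metric_ne_zero hx) hsymm
    (P := Matrix.of fun i j => ∑ k,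
      (![massN'' M (x 1) / (3 * sg a (x 1) (x 2)) - ricciAng a (massN M) (massN' M) (x 1) (x 2),
        massN'' M (x 1) / (3 * sg a (x 1) (x 2)) - ricciAng a (massN M) (massN' M) (x 1) (x 2),
        ricciAng a (massN M) (massN' M) (x 1) (x 2) - massN'' M (x 1) / (6 * sg a (x 1) (x 2)),
        ricciAng a (massN M) (massN' M) (x 1) (x 2) - massN'' M (x 1) / (6 * sg a (x 1) (x 2))] :
        Fin 4 → ℝ) k *
      diagCoeff (sg a (x 1) (x 2)) (dl a (massN M) (x 1)) (Real.sin (x 2)) k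
        * (coframe a (x 1) (x 2) k i * coframe a (x 1) (x 2) k j))
    (fun i j c d => ?_) (typeDTensor_traceFree hS hD hs (trace2_coframe hx))
  rw [riemann_metric hI hM hx, coframe_connMat]
  simp only [metric_apply, typeDTensor, curvForm, biprod, bivec, Matrix.of_apply,
    Fin.sum_univ_four, Pi.add_apply, Pi.smul_apply, smul_eq_mul]
  generalize coframe a (x 1) (x 2) = Θ
  simp [diagCoeff]
  field_simp
  ring

end point

/-! ### Principal null directions of a type D tensor in an adapted frame -/

theorem pairC_toC (α : Fin 4 → ℝ) (n : Pt) : pairC α (toC n) = ((α ⬝ᵥ n : ℝ) : ℂ) := by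
  simp [pairC, toC, dotProduct]

theorem pairC_sub_smul (α : Fin 4 → ℝ) (c d : ℂ) (u v : Fin 4 → ℂ) :
    pairC α (c • u - d • v) = c * pairC α u - d * pairC α v := by
  simp only [pairC, Fin.sum_univ_four, Pi.sub_apply, Pi.smul_apply, smul_eq_mul]
  ring

theorem lower_pairing (g : Mat) (n : Pt) (u : Fin 4 → ℂ) :
    ∑ a, (lower g n a : ℂ) * u a = dotC g u (toC n) := by
  simp only [lower, dotC, toC, Complex.ofReal_sum, Finset.sum_mul]
  refine Finset.sum_congr rfl fun a _ => Finset.sum_congr rfl fun b _ => ?_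
  push_cast
  ring

/-- Supplies an index e with n_e ≠ 0, by which the antisymmetrised conditions can be divided. -/
theorem exists_lower_ne_zero {g : Mat} {n : Pt} {w : Fin 4 → ℂ} (hw : dotC g w (toC n) ≠ 0) :
    ∃ e, lower g n e ≠ 0 := by
  by_contra! h
  refine hw ?_
  rw [← lower_pairing]
  simp [h]

/-- The conditions on principal null directions concern real components; this form allows them to be
tested on complex vectors. -/
theorem contr4_eq_contr2 (C : Tensor4) (n : Pt) (u v : Fin 4 → ℂ) :
    contr4 C u (toC n) (toC n) v = ∑ a, ∑ d, (contr2 C n a d : ℂ) * (u a * v d) := by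
  simp only [contr4, contr2, toC, Complex.ofReal_sum, Finset.sum_mul]
  refine Finset.sum_congr rfl fun a _ => ?_
  rw [Finset.sum_comm' (s := Finset.univ) (t := fun _ => Finset.univ) (t' := Finset.univ)
    (s' := fun _ => Finset.univ) (by simp)]
  rw [Finset.sum_comm]
  refine (Finset.sum_congr rfl fun b _ => ?_).trans Finset.sum_comm
  rw [Finset.sum_comm]
  refine Finset.sum_congr rfl fun d _ => Finset.sum_congr rfl fun c _ => ?_
  push_cast
  ring

theorem contr4_eq_contr1 (C : Tensor4) (n : Pt) (u v w : Fin 4 → ℂ) :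
    contr4 C u v (toC n) w =
      ∑ a, ∑ b, (∑ d, (contr1 C n a b d : ℂ) * w d) * (u a * v b) := by
  simp only [contr4, contr1, toC, Complex.ofReal_sum, Finset.sum_mul]
  refine Finset.sum_congr rfl fun a _ => Finset.sum_congr rfl fun b _ => ?_
  rw [Finset.sum_comm]
  refine Finset.sum_congr rfl fun d _ => Finset.sum_congr rfl fun c _ => ?_
  push_cast
  ring

/-- For a principal null vector `n` and `u` orthogonal to `n` one has `C(u, n, n, u) = 0`. -/
theorem IsPND.contr4_eq_zero {g : Mat} {C : Tensor4} {n : Pt} (h : IsPND g C n)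
    {u w : Fin 4 → ℂ} (hu : dotC g u (toC n) = 0) (hw : dotC g w (toC n) ≠ 0) :
    contr4 C u (toC n) (toC n) u = 0 := by
  obtain ⟨e, he⟩ := exists_lower_ne_zero hw
  have he' : (lower g n e : ℂ) ≠ 0 := by exact_mod_cast he
  rw [← lower_pairing] at hu
  have hmul : (lower g n e : ℂ) ^ 2 * contr4 C u (toC n) (toC n) u = 0 := by
    -- The condition with f = e, solved for its leading term: every other term contains n_a or n_d,
    -- and these vanish when summed against u.
    have hpt : ∀ a d, (lower g n e : ℂ) ^ 2 * ((contr2 C n a d : ℂ) * (u a * u d)) =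
        (lower g n a * u a) * (lower g n e * contr2 C n e d * u d)
          + (lower g n e * contr2 C n a e * u a) * (lower g n d * u d)
          - (lower g n a * u a) * (contr2 C n e e * (lower g n d * u d)) := by
      intro a d
      have := congrArg (fun y : ℝ => (y : ℂ)) (h.2 e a d e)
      push_cast at this
      linear_combination (u a * u d) * this
    rw [contr4_eq_contr2]
    simp only [Finset.mul_sum, hpt, Finset.sum_add_distrib, Finset.sum_sub_distrib]
    simp only [← Finset.mul_sum, ← Finset.sum_mul, hu]
    simp
  exact (mul_eq_zero.mp hmul).resolve_left (pow_ne_zero 2 he')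

/-- For a null vector `n` of multiplicity at least three and `w` orthogonal to `n` one has
`C(·, ·, n, w) = 0`. -/
theorem IsPNDGeThree.contr4_eq_zero {g : Mat} {C : Tensor4} {n : Pt} (h : IsPNDGeThree g C n)
    {w z : Fin 4 → ℂ} (hw : dotC g w (toC n) = 0) (hz : dotC g z (toC n) ≠ 0)
    (u v : Fin 4 → ℂ) : contr4 C u v (toC n) w = 0 := by
  obtain ⟨e, he⟩ := exists_lower_ne_zero hz
  have he' : (lower g n e : ℂ) ≠ 0 := by exact_mod_cast he
  rw [← lower_pairing] at hw
  have hzero : ∀ a b, ∑ d, (contr1 C n a b d : ℂ) * w d = 0 := by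
    intro a b
    refine (mul_eq_zero.mp ?_).resolve_left he'
    have hpt : ∀ d, (lower g n e : ℂ) * ((contr1 C n a b d : ℂ) * w d)
        = contr1 C n a b e * (lower g n d * w d) := by
      intro d
      have := congrArg (fun y : ℝ => (y : ℂ)) (h.2 a b d e)
      push_cast at this
      linear_combination (w d) * this
    rw [Finset.mul_sum]
    simp only [hpt, ← Finset.mul_sum, hw, mul_zero]
  rw [contr4_eq_contr1]
  simp [hzero]

theorem contr2_add (C C' : Tensor4) (n : Pt) (a d : Fin 4) :
    contr2 (C + C') n a d = contr2 C n a d + contr2 C' n a d := by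
  simp only [contr2, Pi.add_apply, add_mul, Finset.sum_add_distrib]

theorem contr2_smul (r : ℝ) (C : Tensor4) (n : Pt) (a d : Fin 4) :
    contr2 (r • C) n a d = r * contr2 C n a d := by
  simp only [contr2, Pi.smul_apply, smul_eq_mul, Finset.mul_sum, mul_assoc]

theorem contr2_biprod (α β γ δ : Fin 4 → ℝ) (n : Pt) (a d : Fin 4) :
    contr2 (biprod α β γ δ) n a d =
      (α a * (β ⬝ᵥ n) - β a * (α ⬝ᵥ n)) * ((γ ⬝ᵥ n) * δ d - (δ ⬝ᵥ n) * γ d) := by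
  simp only [contr2, biprod, bivec, dotProduct, Fin.sum_univ_four]
  ring

theorem dotC_eq {g Θ : Mat} {h : Fin 4 → ℝ} (hg : ∀ i j, g i j = ∑ k, h k * (Θ k i * Θ k j))
    (u v : Fin 4 → ℂ) :
    dotC g u v = ∑ k, (h k : ℂ) * (pairC (Θ k) u * pairC (Θ k) v) := by
  simp only [dotC, hg, pairC, Fin.sum_univ_four]
  push_cast
  ring

theorem lower_eq {g Θ : Mat} {h : Fin 4 → ℝ} (hg : ∀ i j, g i j = ∑ k, h k * (Θ k i * Θ k j))
    (n : Pt) (a : Fin 4) : lower g n a = ∑ k, h k * (Θ k ⬝ᵥ n) * Θ k a := by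
  simp only [lower, hg, dotProduct, Fin.sum_univ_four]
  ring

theorem norm_sq_eq {g Θ : Mat} {h : Fin 4 → ℝ} (hg : ∀ i j, g i j = ∑ k, h k * (Θ k i * Θ k j))
    (n : Pt) : ∑ a, ∑ b, g a b * n a * n b = ∑ k, h k * (Θ k ⬝ᵥ n) ^ 2 := by
  simp only [hg, dotProduct, Fin.sum_univ_four]
  ring

theorem typeDTensor_zero (S D s : ℝ) (θ : Mat) : typeDTensor S D s 0 0 θ = 0 := by
  simp [typeDTensor]

/-- `Ψ₂ ≠ 0` is necessary for type D. -/
theorem IsPetrovTypeD.typeDTensor_ne_zero {g : Mat} {S D s p q : ℝ} {θ : Mat}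
    (h : IsPetrovTypeD g (typeDTensor S D s p q θ)) : (p : ℂ) + q * Complex.I ≠ 0 := by
  intro h0
  have hp : p = 0 := by simpa using congrArg Complex.re h0
  have hq : q = 0 := by simpa using congrArg Complex.im h0
  obtain ⟨n, _, _, hn, _⟩ := h
  rw [hp, hq, typeDTensor_zero] at hn
  -- For the zero tensor every null vector has multiplicity at least three, so none is exactly
  -- double.
  refine hn.2 ⟨hn.1.1, fun a b d e => ?_⟩
  simp [contr1]

section adapted

variable {g Θ : Mat} {S D s p q : ℝ} {l k : Pt} {m m' : Fin 4 → ℂ} {μ ν : ℂ}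

/-- The vectors `l`, `k`, `m`, `m'` have the components of the standard null tetrad in the coframe
`Θ`. -/
structure AdaptedTetrad (g Θ : Mat) (S D s : ℝ) (l k : Pt) (m m' : Fin 4 → ℂ) (μ ν : ℂ) :
    Prop where
  hS : S ≠ 0
  hD : D ≠ 0
  hs : s ≠ 0
  hg : ∀ i j, g i j = ∑ k, diagCoeff S D s k * (Θ k i * Θ k j)
  hdet : Θ.det ≠ 0
  hl : ∀ i, Θ i ⬝ᵥ l = (![S / D, 1, 0, 0] : Fin 4 → ℝ) i
  hk : ∀ i, Θ i ⬝ᵥ k = (![1 / 2, -(D / (2 * S)), 0, 0] : Fin 4 → ℝ) i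
  hm : ∀ i, pairC (Θ i) m = μ * (![0, 0, 1, -(Complex.I * (S / s))] : Fin 4 → ℂ) i
  hm' : ∀ i, pairC (Θ i) m' = ν * (![0, 0, 1, Complex.I * (S / s)] : Fin 4 → ℂ) i
  hμν : μ * ν * (2 * S) = 1

namespace AdaptedTetrad

theorem eq_of_components (h : AdaptedTetrad g Θ S D s l k m m' μ ν) {u v : Pt}
    (huv : ∀ i, Θ i ⬝ᵥ u = Θ i ⬝ᵥ v) : u = v := by
  have hinj := Matrix.mulVec_injective_iff_isUnit.mpr
    ((Matrix.isUnit_iff_isUnit_det Θ).mpr (isUnit_iff_ne_zero.mpr h.hdet))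
  exact hinj (funext huv)

theorem dot_eq (h : AdaptedTetrad g Θ S D s l k m m' μ ν) (u v : Fin 4 → ℂ) :
    dotC g u v = -(D / S) * (pairC (Θ 0) u * pairC (Θ 0) v)
      + S / D * (pairC (Θ 1) u * pairC (Θ 1) v) + S * (pairC (Θ 2) u * pairC (Θ 2) v)
      + s ^ 2 / S * (pairC (Θ 3) u * pairC (Θ 3) v) := by
  rw [dotC_eq h.hg, Fin.sum_univ_four]
  simp [diagCoeff]

theorem products (h : AdaptedTetrad g Θ S D s l k m m' μ ν) :
    dotC g (toC l) (toC l) = 0 ∧ dotC g (toC k) (toC k) = 0 ∧ dotC g m m = 0 ∧ dotC g m' m' = 0 ∧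
      dotC g (toC l) (toC k) = -1 ∧ dotC g m m' = 1 ∧ dotC g (toC l) m = 0 ∧
      dotC g (toC l) m' = 0 ∧ dotC g (toC k) m = 0 ∧ dotC g (toC k) m' = 0 := by
  have hS : (S : ℂ) ≠ 0 := by exact_mod_cast h.hS
  have hD : (D : ℂ) ≠ 0 := by exact_mod_cast h.hD
  have hs : (s : ℂ) ≠ 0 := by exact_mod_cast h.hs
  simp only [h.dot_eq, pairC_toC, h.hl, h.hk, h.hm, h.hm']
  refine ⟨?_, ?_, ?_, ?_, ?_, ?_, ?_, ?_, ?_, ?_⟩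
  · simp
    field_simp
    ring
  · simp
    field_simp
    ring
  · simp
    field_simp
    linear_combination (S * μ ^ 2) * Complex.I_sq
  · simp
    field_simp
    linear_combination (S * ν ^ 2) * Complex.I_sq
  · simp
    field_simp
    ring
  · simp
    field_simp
    linear_combination h.hμν - S * μ * ν * Complex.I_sq
  all_goals simp

/-- The bivector of l and k has only the component 01, which the tensor couples to 01 and 23 alone,
while those of l, m and k, m' have neither; hence Ψ₁ = Ψ₃ = 0. In Ψ₀ and Ψ₄ the four remaining terms
in p cancel, and so do those in q. Only Ψ₂ sees the normalisation of m and m', through the product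
μν. -/
theorem scalars (h : AdaptedTetrad g Θ S D s l k m m' μ ν) :
    contr4 (typeDTensor S D s p q Θ) (toC l) m (toC l) m = 0 ∧
      contr4 (typeDTensor S D s p q Θ) (toC l) (toC k) (toC l) m = 0 ∧
      contr4 (typeDTensor S D s p q Θ) (toC k) (toC l) (toC k) m' = 0 ∧
      contr4 (typeDTensor S D s p q Θ) (toC k) m' (toC k) m' = 0 ∧
      contr4 (typeDTensor S D s p q Θ) (toC l) m m' (toC k) = p + q * Complex.I := by
  have hS : (S : ℂ) ≠ 0 := by exact_mod_cast h.hS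
  have hD : (D : ℂ) ≠ 0 := by exact_mod_cast h.hD
  have hs : (s : ℂ) ≠ 0 := by exact_mod_cast h.hs
  simp only [contr4_typeDTensor, bivecC, pairC_toC, h.hl, h.hk, h.hm, h.hm']
  refine ⟨?_, ?_, ?_, ?_, ?_⟩
  · simp
    field_simp
    ring
  · simp
  · simp
  · simp
    field_simp
    ring
  · simp
    field_simp
    linear_combination 2 * (p + q * Complex.I) * h.hμν - 2 * S * μ * ν * p * Complex.I_sq

theorem isNullVec_l (h : AdaptedTetrad g Θ S D s l k m m' μ ν) : IsNullVec g l := by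
  have hS := h.hS
  have hD := h.hD
  refine ⟨fun h0 => ?_, ?_⟩
  · have := h.hl 1
    simp [h0] at this
  · rw [norm_sq_eq h.hg, Fin.sum_univ_four]
    simp only [h.hl]
    simp [diagCoeff]
    field_simp
    ring

theorem isNullVec_k (h : AdaptedTetrad g Θ S D s l k m m' μ ν) : IsNullVec g k := by
  have hS := h.hS
  have hD := h.hD
  refine ⟨fun h0 => ?_, ?_⟩
  · have := h.hk 0
    simp [h0] at this
  · rw [norm_sq_eq h.hg, Fin.sum_univ_four]
    simp only [h.hk]
    simp [diagCoeff]
    field_simp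
    ring

theorem linearIndependent (h : AdaptedTetrad g Θ S D s l k m m' μ ν) :
    LinearIndependent ℝ ![l, k] := by
  have hS := h.hS
  have hD := h.hD
  rw [LinearIndependent.pair_iff]
  intro α β hαβ
  have hi : ∀ i, α * (Θ i ⬝ᵥ l) + β * (Θ i ⬝ᵥ k) = 0 := by
    intro i
    have := congrArg (fun v => Θ i ⬝ᵥ v) hαβ
    simpa [dotProduct_add, dotProduct_smul] using this
  have h0 := hi 0
  have h1 := hi 1
  rw [h.hl, h.hk] at h0 h1
  simp at h0 h1
  field_simp at h0 h1
  have hβ : β = 0 := by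
    have : (4 * D * S) * β = 0 := by linear_combination 2 * S * h0 - 2 * S * h1
    simpa [hS, hD] using this
  subst hβ
  simp [hS] at h1
  exact ⟨h1, rfl⟩

/-- The double contraction is -2p l_a l_d, a multiple of l_d, whatever p and q are; nonvanishing of
Ψ₂ matters only for excluding multiplicity three. -/
theorem isPNDGeTwo_l (h : AdaptedTetrad g Θ S D s l k m m' μ ν) :
    IsPNDGeTwo g (typeDTensor S D s p q Θ) l := by
  have hS := h.hS
  have hD := h.hD
  have h2 : ∀ a d, contr2 (typeDTensor S D s p q Θ) l a d =
      -2 * p * lower g l a * lower g l d := by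
    intro a d
    rw [lower_eq h.hg, lower_eq h.hg]
    simp only [typeDTensor, contr2_add, contr2_smul, contr2_biprod, h.hl, Fin.sum_univ_four]
    simp [diagCoeff]
    field_simp
    ring
  refine ⟨h.isNullVec_l, fun a d e => ?_⟩
  rw [h2, h2]
  ring

theorem isPNDGeTwo_k (h : AdaptedTetrad g Θ S D s l k m m' μ ν) :
    IsPNDGeTwo g (typeDTensor S D s p q Θ) k := by
  have hS := h.hS
  have hD := h.hD
  have h2 : ∀ a d, contr2 (typeDTensor S D s p q Θ) k a d =
      -2 * p * lower g k a * lower g k d := by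
    intro a d
    rw [lower_eq h.hg, lower_eq h.hg]
    simp only [typeDTensor, contr2_add, contr2_smul, contr2_biprod, h.hk, Fin.sum_univ_four]
    simp [diagCoeff]
    field_simp
    ring
  refine ⟨h.isNullVec_k, fun a d e => ?_⟩
  rw [h2, h2]
  ring

theorem contr4_pair_symm (S D s p q : ℝ) (Θ : Mat) (u v w z : Fin 4 → ℂ) :
    contr4 (typeDTensor S D s p q Θ) u v w z = contr4 (typeDTensor S D s p q Θ) w z u v := by
  simp only [contr4_typeDTensor]
  ring

theorem contr4_swap (S D s p q : ℝ) (Θ : Mat) (u v w z : Fin 4 → ℂ) :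
    contr4 (typeDTensor S D s p q Θ) u v w z = -contr4 (typeDTensor S D s p q Θ) u v z w := by
  simp only [contr4_typeDTensor, bivecC]
  ring

theorem dotC_comm (h : AdaptedTetrad g Θ S D s l k m m' μ ν) (u v : Fin 4 → ℂ) :
    dotC g u v = dotC g v u := by
  rw [h.dot_eq, h.dot_eq]
  ring

/-- Pair symmetry gives Ψ₂ = C(m', k, l, m). Since m is orthogonal to l, this would vanish if l had
multiplicity three. -/
theorem isDoublePND_l (h : AdaptedTetrad g Θ S D s l k m m' μ ν)
    (hψ : (p : ℂ) + q * Complex.I ≠ 0) : IsDoublePND g (typeDTensor S D s p q Θ) l := by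
  refine ⟨h.isPNDGeTwo_l, fun h3 => hψ ?_⟩
  obtain ⟨-, -, -, -, hlk, -, hlm, -, -, -⟩ := h.products
  obtain ⟨-, -, -, -, h2⟩ := h.scalars (p := p) (q := q)
  rw [← h2, contr4_pair_symm]
  refine h3.contr4_eq_zero (z := toC k) ?_ ?_ _ _
  · rw [h.dotC_comm, hlm]
  · rw [h.dotC_comm, hlk]
    norm_num

/-- Here Ψ₂ = -C(l, m, k, m') and m' is orthogonal to k, so multiplicity three would again give Ψ₂ =
0. -/
theorem isDoublePND_k (h : AdaptedTetrad g Θ S D s l k m m' μ ν)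
    (hψ : (p : ℂ) + q * Complex.I ≠ 0) : IsDoublePND g (typeDTensor S D s p q Θ) k := by
  refine ⟨h.isPNDGeTwo_k, fun h3 => hψ ?_⟩
  obtain ⟨-, -, -, -, hlk, -, -, -, -, hkm⟩ := h.products
  obtain ⟨-, -, -, -, h2⟩ := h.scalars (p := p) (q := q)
  rw [← h2, contr4_swap, neg_eq_zero]
  refine h3.contr4_eq_zero (z := toC l) ?_ ?_ _ _
  · rw [h.dotC_comm, hkm]
  · rw [hlk]
    norm_num

/-- The component of a type D tensor that detects principal null vectors: for null `n` with
components `nᵢ`, a vector `u` orthogonal to `n` satisfies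
`C(u, n, n, u) = -6 Ψ̄₂ (S n₂ - i s n₃)² (S n₁ - D n₀)²`. -/
theorem detector (hS : S ≠ 0) (hD : D ≠ 0) (hs : s ≠ 0) {n : Fin 4 → ℝ}
    (hn : -(D / S) * n 0 ^ 2 + S / D * n 1 ^ 2 + S * n 2 ^ 2 + s ^ 2 / S * n 3 ^ 2 = 0)
    {u v : Fin 4 → ℂ} (hv : ∀ i, pairC (Θ i) v = n i)
    (hu : ∀ i, pairC (Θ i) u = (![-(S * n 2 - Complex.I * s * n 3) * S,
      -(S * n 2 - Complex.I * s * n 3) * D, S * n 1 - D * n 0,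
      -(Complex.I * (S / s)) * (S * n 1 - D * n 0)] : Fin 4 → ℂ) i) :
    contr4 (typeDTensor S D s p q Θ) u v v u = -6 * (p - q * Complex.I)
      * (S * n 2 - Complex.I * s * n 3) ^ 2 * (S * n 1 - D * n 0) ^ 2 := by
  have hS' : (S : ℂ) ≠ 0 := by exact_mod_cast hS
  have hD' : (D : ℂ) ≠ 0 := by exact_mod_cast hD
  have hs' : (s : ℂ) ≠ 0 := by exact_mod_cast hs
  have hI : Complex.I ^ 2 = -1 := Complex.I_sq
  set X : ℂ := S * n 1 - D * n 0 with hX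
  set z : ℂ := S * n 2 - Complex.I * s * n 3 with hz
  have hnull : (-(D ^ 2) * n 0 ^ 2 + S ^ 2 * n 1 ^ 2
      + D * (S ^ 2 * n 2 ^ 2 + s ^ 2 * n 3 ^ 2) : ℂ) = 0 := by
    have : -(D ^ 2) * n 0 ^ 2 + S ^ 2 * n 1 ^ 2
        + D * (S ^ 2 * n 2 ^ 2 + s ^ 2 * n 3 ^ 2) = 0 := by
      have e := congrArg (fun y => D * S * y) hn
      simp only [mul_zero] at e
      rw [← e]
      field_simp
      ring
    exact_mod_cast this
  have b01 : bivecC (Θ 0) (Θ 1) u v = -(z * X) := by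
    simp only [bivecC, hu, hv]
    simp [hX]
    ring
  have b23 : bivecC (Θ 2) (Θ 3) u v = Complex.I / s * (z * X) := by
    simp only [bivecC, hu, hv]
    simp [hz]
    field_simp
    linear_combination (s * n 3 * X) * hI
  have b02 : bivecC (Θ 0) (Θ 2) u v = (X ^ 2 / D - z ^ 2) / 2 := by
    simp only [bivecC, hu, hv]
    simp
    field_simp
    rw [hX, hz]
    linear_combination -hnull + D * s ^ 2 * n 3 ^ 2 * hI
  have b13 : bivecC (Θ 1) (Θ 3) u v = Complex.I * D / s * ((X ^ 2 / D - z ^ 2) / 2) := by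
    simp only [bivecC, hu, hv]
    simp
    field_simp
    rw [hX, hz]
    linear_combination Complex.I * hnull - D * (Complex.I * s ^ 2 * n 3 ^ 2 + 2 * s * n 3 * z) * hI
  have b12 : bivecC (Θ 1) (Θ 2) u v = -(D / S) * ((X ^ 2 / D + z ^ 2) / 2) := by
    simp only [bivecC, hu, hv]
    simp
    field_simp
    rw [hX, hz]
    linear_combination -hnull + D * s ^ 2 * n 3 ^ 2 * hI
  have b03 : bivecC (Θ 0) (Θ 3) u v = -(Complex.I * S / s) * ((X ^ 2 / D + z ^ 2) / 2) := by
    simp only [bivecC, hu, hv]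
    simp
    field_simp
    rw [hX, hz]
    linear_combination Complex.I * hnull - D * (Complex.I * s ^ 2 * n 3 ^ 2 + 2 * s * n 3 * z) * hI
  have hskew : ∀ i j, bivecC (Θ i) (Θ j) v u = -bivecC (Θ i) (Θ j) u v := fun i j => by
    simp only [bivecC]
    ring
  -- The pairs 02, 13 carry (X²/D - z²)/2 and the pairs 03, 12 carry (X²/D + z²)/2. The squares
  -- differ by z²X²/D, so these terms combine with those of 01, 23 into a multiple of (zX)².
  simp only [contr4_typeDTensor, hskew, b01, b23, b02, b13, b12, b03]
  clear_value X z
  field_simp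
  linear_combination 12 * p * D * (z * X) ^ 2 * hI

/-- A type D tensor has no principal null directions besides those of `l` and `k`. -/
theorem eq_smul_of_isPND (h : AdaptedTetrad g Θ S D s l k m m' μ ν)
    (hψ : (p : ℂ) + q * Complex.I ≠ 0) {n : Pt} (hn : IsPND g (typeDTensor S D s p q Θ) n) :
    ∃ c : ℝ, n = c • l ∨ n = c • k := by
  have hS := h.hS
  have hD := h.hD
  have hs := h.hs
  have hS' : (S : ℂ) ≠ 0 := by exact_mod_cast hS
  have hD' : (D : ℂ) ≠ 0 := by exact_mod_cast hD
  have hs' : (s : ℂ) ≠ 0 := by exact_mod_cast hs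
  have hμ : μ ≠ 0 := by
    rintro rfl
    simpa using h.hμν
  obtain ⟨c, hc⟩ : ∃ c : Fin 4 → ℝ, ∀ i, Θ i ⬝ᵥ n = c i := ⟨_, fun i => rfl⟩
  have hnull : -(D / S) * c 0 ^ 2 + S / D * c 1 ^ 2 + S * c 2 ^ 2 + s ^ 2 / S * c 3 ^ 2 = 0 := by
    have := hn.1.2
    rw [norm_sq_eq h.hg, Fin.sum_univ_four] at this
    simpa [diagCoeff, hc] using this
  have hnull' : (S * c 1 - D * c 0) * (S * c 1 + D * c 0)
      + D * ((S * c 2) ^ 2 + (s * c 3) ^ 2) = 0 := by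
    have e := congrArg (fun y => D * S * y) hnull
    simp only [mul_zero] at e
    rw [← e]
    field_simp
    ring
  have hsum : (S * c 2) ^ 2 + (s * c 3) ^ 2 = 0 → c 2 = 0 ∧ c 3 = 0 := by
    intro h0
    have h2 : S * c 2 = 0 := by nlinarith [sq_nonneg (S * c 2), sq_nonneg (s * c 3)]
    have h3 : s * c 3 = 0 := by nlinarith [sq_nonneg (S * c 2), sq_nonneg (s * c 3)]
    exact ⟨(mul_eq_zero.mp h2).resolve_left hS, (mul_eq_zero.mp h3).resolve_left hs⟩
  -- The quantity S c₁ - D c₀ is D times l·n. If it vanishes, nullity leaves a sum of two squares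
  -- equal to zero, so n is parallel to l; the factor is c₁ because l has component 1 there.
  by_cases hX : S * c 1 - D * c 0 = 0
  · refine ⟨c 1, Or.inl (h.eq_of_components fun i => ?_)⟩
    rw [hX, zero_mul, zero_add] at hnull'
    obtain ⟨h2, h3⟩ := hsum ((mul_eq_zero.mp hnull').resolve_left hD)
    rw [dotProduct_smul, hc, h.hl]
    fin_cases i
    · simp
      field_simp
      linear_combination -hX
    · simp
    · simp [h2]
    · simp [h3]
  · have hX' : (S * c 1 - D * c 0 : ℂ) ≠ 0 := by exact_mod_cast hX
    have hv : ∀ i, pairC (Θ i) (toC n) = c i := fun i => by rw [pairC_toC, hc]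
    set z : ℂ := S * c 2 - Complex.I * s * c 3 with hz
    -- Since m·n = μz and l·n = X/D with X = S c₁ - D c₀, the combination (X/μ) m - zD l is
    -- orthogonal to n.
    have hu : ∀ i, pairC (Θ i) (((S * c 1 - D * c 0) / μ) • m - (z * D) • toC l) =
        (![-z * S, -z * D, S * c 1 - D * c 0, -(Complex.I * (S / s)) * (S * c 1 - D * c 0)] :
          Fin 4 → ℂ) i := by
      intro i
      rw [pairC_sub_smul, h.hm, pairC_toC, h.hl]
      fin_cases i <;> simp <;> field_simp
    have horth : dotC g (((S * c 1 - D * c 0) / μ) • m - (z * D) • toC l) (toC n) = 0 := by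
      rw [h.dot_eq]
      simp only [hu, hv]
      simp [hz]
      field_simp
      ring
    have hl : dotC g (toC l) (toC n) ≠ 0 := by
      rw [h.dot_eq]
      simp only [hv, pairC_toC, h.hl]
      have : (S * c 1 - D * c 0 : ℂ) / D ≠ 0 := div_ne_zero hX' hD'
      convert this using 1
      simp
      field_simp
      ring
    have h0 := hn.contr4_eq_zero horth hl
    rw [detector hS hD hs hnull hv hu] at h0
    have hψ' : (p : ℂ) - q * Complex.I ≠ 0 := by
      intro h0
      have hp : p = 0 := by simpa using congrArg Complex.re h0
      have hq : q = 0 := by simpa using congrArg Complex.im h0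
      exact hψ (by simp [hp, hq])
    have hz0 : z = 0 := by
      simpa [hψ', hX'] using h0
    have h2 : S * c 2 = 0 := by simpa [hz] using congrArg Complex.re hz0
    have h3 : s * c 3 = 0 := by simpa [hz] using congrArg Complex.im hz0
    rw [h2, h3] at hnull'
    -- As c₂ and c₃ are real, z = 0 kills both, and nullity with X ≠ 0 leaves S c₁ + D c₀ = 0, the
    -- relation satisfied by k. The factor is 2c₀ because the component of k with index 0 is 1/2.
    have hY : S * c 1 + D * c 0 = 0 := by simpa [hX] using hnull'
    refine ⟨2 * c 0, Or.inr (h.eq_of_components fun i => ?_)⟩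
    rw [dotProduct_smul, hc, h.hk]
    fin_cases i
    · simp
      ring
    · simp
      field_simp
      linear_combination hY
    · simpa [hS] using h2
    · simpa [hs] using h3

theorem hasDoublePNDPair (h : AdaptedTetrad g Θ S D s l k m m' μ ν)
    (hψ : (p : ℂ) + q * Complex.I ≠ 0) :
    HasDoublePNDPair g (typeDTensor S D s p q Θ) l k :=
  ⟨h.linearIndependent, h.isDoublePND_l hψ, h.isDoublePND_k hψ, fun _ hn =>
    h.eq_smul_of_isPND hψ hn⟩

end AdaptedTetrad

end adapted

/-! ### The Kerr-like tetrad -/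

theorem rhoC_mul_rhoBar (a : ℝ) (x : Pt) : rhoC a x * rhoBar a x = sg a (x 1) (x 2) := by
  simp only [rhoC, rhoBar, sg]
  push_cast
  linear_combination -(a ^ 2 * Complex.cos (x 2) ^ 2) * Complex.I_sq

theorem conj_rhoC (a : ℝ) (x : Pt) : starRingEnd ℂ (rhoC a x) = rhoBar a x := by
  simp [rhoC, rhoBar, -Complex.ofReal_cos, Complex.conj_ofReal]
  ring

/-- The scalings of m and its conjugate are 1/(√2 ϱ) and 1/(√2 ϱ̄); their product is 1/(2Σ) because
ϱϱ̄ = Σ. -/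
theorem adaptedTetrad_kerr {a : ℝ} {M : ℝ → ℝ} {I : Set ℝ} {x : Pt} (hx : x ∈ domain a M I) :
    AdaptedTetrad (metric a M x) (coframe a (x 1) (x 2)) (sg a (x 1) (x 2))
      (dl a (massN M) (x 1)) (Real.sin (x 2)) (vecL a M x) (vecK a M x) (vecM a x)
      (conjVec (vecM a x)) (1 / ((Real.sqrt 2 : ℂ) * rhoC a x))
      (1 / ((Real.sqrt 2 : ℂ) * rhoBar a x)) := by
  have hS := sg_ne_zero hx
  have hD := dl_ne_zero hx
  have hs := sin_ne_zero hx
  have hs' : Complex.sin (x 2) ≠ 0 := by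
    rw [← Complex.ofReal_sin]
    exact_mod_cast hs
  have hconj : starRingEnd ℂ (Complex.sin (x 2)) = Complex.sin (x 2) := by
    rw [← Complex.ofReal_sin, Complex.conj_ofReal]
  have hS' : (sg a (x 1) (x 2) : ℂ) ≠ 0 := by exact_mod_cast hS
  have hρ := rhoC_mul_rhoBar a x
  have hρ1 : rhoC a x ≠ 0 := fun h0 => hS' (by rw [← hρ, h0, zero_mul])
  have hρ2 : rhoBar a x ≠ 0 := fun h0 => hS' (by rw [← hρ, h0, mul_zero])
  have h2 : (Real.sqrt 2 : ℂ) ^ 2 = 2 := by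
    rw [← Complex.ofReal_pow, Real.sq_sqrt (by norm_num)]
    norm_num
  have h2' : (Real.sqrt 2 : ℂ) ≠ 0 := by
    intro h0
    rw [h0] at h2
    norm_num at h2
  have hsg : sg a (x 1) (x 2) = x 1 ^ 2 + a ^ 2 - a ^ 2 * Real.sin (x 2) ^ 2 := by
    rw [sg, Real.cos_sq']
    ring
  refine ⟨hS, hD, hs, metric_apply a M x, det_coframe_ne_zero hx, ?_, ?_, ?_, ?_, ?_⟩
  · intro i
    rw [vecL, dotProduct_smul, del_eq]
    fin_cases i <;> simp [coframe, dotProduct, Fin.sum_univ_four] <;> field_simp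
    · rw [hsg]
      ring
    · right
      ring
  · intro i
    rw [vecK, dotProduct_smul, del_eq, sig_eq]
    fin_cases i <;> simp [coframe, dotProduct, Fin.sum_univ_four] <;> field_simp
    · rw [hsg]
      ring
    · right
      ring
  · intro i
    fin_cases i <;> simp [coframe, pairC, vecM, Fin.sum_univ_four, hsg]
    all_goals
      field_simp
      ring
  · intro i
    fin_cases i <;>
      simp [coframe, pairC, conjVec, vecM, Fin.sum_univ_four, conj_rhoC, hsg, hconj]
    all_goals
      field_simp
      ring
  · rw [← hρ]
    field_simp
    rw [h2]

/-! ### The closed form of Ψ₂ -/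

section formula

variable {a : ℝ} {M : ℝ → ℝ} {I : Set ℝ} {x : Pt}

theorem rhoC_ne_zero (hx : x ∈ domain a M I) : rhoC a x ≠ 0 := fun h0 => by
  have h := rhoC_mul_rhoBar a x
  rw [h0, zero_mul] at h
  exact sg_ne_zero hx (by exact_mod_cast h.symm)

theorem rhoBar_ne_zero (hx : x ∈ domain a M I) : rhoBar a x ≠ 0 := fun h0 => by
  have h := rhoC_mul_rhoBar a x
  rw [h0, mul_zero] at h
  exact sg_ne_zero hx (by exact_mod_cast h.symm)

/-- The numerator of `Ψ₂`. -/
def psiNum (a : ℝ) (M : ℝ → ℝ) (x : Pt) : ℂ :=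
  6 * rhoC a x * (M (x 1) : ℂ)
    - 2 * ((x 1 : ℂ) + rhoC a x) * rhoBar a x * ((deriv M (x 1) : ℝ) : ℂ)
    + (x 1 : ℂ) * rhoBar a x ^ 2 * ((deriv (deriv M) (x 1) : ℝ) : ℂ)

/-- Real and imaginary parts combine through ϱ² = r² - a² cos²θ + 2i a r cos θ into -(12ϱ²N - 6ΣϱN'
+ Σ²N'')/(12Σ³). With Σ = ϱϱ̄ a factor ϱ² cancels, and 2r = ϱ + ϱ̄ turns N back into M. -/
theorem psi_eq (hx : x ∈ domain a M I) :
    (psiRe a (massN M) (massN' M) (massN'' M) (x 1) (x 2) : ℂ)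
      + psiIm a (massN M) (massN' M) (x 1) (x 2) * Complex.I
      = -(psiNum a M x / (6 * rhoC a x * rhoBar a x ^ 3)) := by
  have hρ := rhoC_ne_zero hx
  have hρ' := rhoBar_ne_zero hx
  have hS : (sg a (x 1) (x 2) : ℂ) ≠ 0 := by exact_mod_cast sg_ne_zero hx
  have h1 : (psiRe a (massN M) (massN' M) (massN'' M) (x 1) (x 2) : ℂ)
      + psiIm a (massN M) (massN' M) (x 1) (x 2) * Complex.I
      = -(12 * rhoC a x ^ 2 * massN M (x 1) - 6 * sg a (x 1) (x 2) * rhoC a x * massN' M (x 1)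
        + sg a (x 1) (x 2) ^ 2 * massN'' M (x 1)) / (12 * sg a (x 1) (x 2) ^ 3) := by
    simp only [psiRe, psiIm, rhoC]
    push_cast
    field_simp
    linear_combination (24 * (a * Complex.cos (x 2)) ^ 2 * massN M (x 1)) * Complex.I_sq
  have h2 : (x 1 : ℂ) = (rhoC a x + rhoBar a x) / 2 := by
    simp only [rhoC, rhoBar]
    ring
  rw [h1, ← rhoC_mul_rhoBar, psiNum]
  simp only [massN, massN', massN'']
  push_cast
  rw [h2]
  field_simp
  ring

theorem kerrPsi2_eq (hI : IsOpen I) (hM : ContDiffOn ℝ 3 M I) (hx : x ∈ domain a M I) :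
    kerrPsi2 a M x = psiRe a (massN M) (massN' M) (massN'' M) (x 1) (x 2)
      + psiIm a (massN M) (massN' M) (x 1) (x 2) * Complex.I := by
  rw [kerrPsi2, Psi2, weyl_metric hI hM hx]
  exact (adaptedTetrad_kerr hx).scalars.2.2.2.2

theorem kerrPsi2_formula (hI : IsOpen I) (hM : ContDiffOn ℝ 3 M I) (hx : x ∈ domain a M I) :
    kerrPsi2 a M x = -(psiNum a M x / (6 * rhoC a x * rhoBar a x ^ 3)) := by
  rw [kerrPsi2_eq hI hM hx, psi_eq hx]

theorem kerrPsi2_eq_zero_iff (hI : IsOpen I) (hM : ContDiffOn ℝ 3 M I) (hx : x ∈ domain a M I) :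
    kerrPsi2 a M x = 0 ↔ psiNum a M x = 0 := by
  rw [kerrPsi2_formula hI hM hx]
  simp [rhoC_ne_zero hx, rhoBar_ne_zero hx]

end formula

/-! ### Openness of the set Ψ₂ ≠ 0 and its density where M ≠ 0 -/

section topology

variable {a : ℝ} {M : ℝ → ℝ} {I : Set ℝ}

theorem continuousOn_psiNum (hI : IsOpen I) (hM : ContDiffOn ℝ 3 M I) :
    ContinuousOn (psiNum a M) (domain a M I) := by
  have hc : ∀ f : ℝ → ℝ, ContinuousOn f I →
      ContinuousOn (fun x : Pt => ((f (x 1) : ℝ) : ℂ)) (domain a M I) := fun f hf =>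
    Complex.continuous_ofReal.comp_continuousOn
      (hf.comp (continuous_apply 1).continuousOn fun x hx => hx.1)
  have h0 := hc M hM.continuousOn
  have h1 := hc _ (contDiffOn_deriv_mass hI hM).continuousOn
  have h2 := hc _ (contDiffOn_deriv_deriv_mass hI hM).continuousOn
  have hx1 : Continuous fun x : Pt => ((x 1 : ℝ) : ℂ) :=
    Complex.continuous_ofReal.comp (continuous_apply 1)
  have hb : Continuous fun x : Pt => Complex.I * ((a * Real.cos (x 2) : ℝ) : ℂ) :=
    continuous_const.mul (Complex.continuous_ofReal.comp
      (continuous_const.mul (Real.continuous_cos.comp (continuous_apply 2))))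
  have hρ : Continuous (rhoC a) := hx1.add hb
  have hρ' : Continuous (rhoBar a) := hx1.sub hb
  exact (((continuous_const.mul hρ).continuousOn.mul h0).sub
    (((continuous_const.mul (hx1.add hρ)).mul hρ').continuousOn.mul h1)).add
    ((hx1.mul (hρ'.pow 2)).continuousOn.mul h2)

theorem isOpen_kerrPsi2_ne_zero (hI : IsOpen I) (hM : ContDiffOn ℝ 3 M I) :
    IsOpen {x ∈ domain a M I | kerrPsi2 a M x ≠ 0} := by
  convert (continuousOn_psiNum (a := a) hI hM).isOpen_inter_preimage (isOpen_domain a hI hM)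
    (isOpen_compl_singleton (x := (0 : ℂ))) using 1
  ext x
  simp only [Set.mem_ofPred_eq, Set.mem_inter_iff, Set.mem_preimage, Set.mem_compl_iff,
    Set.mem_singleton_iff]
  exact and_congr_right fun hx => not_congr (kerrPsi2_eq_zero_iff hI hM hx)

theorem psiNum_re (a : ℝ) (M : ℝ → ℝ) (x : Pt) :
    (psiNum a M x).re = 6 * x 1 * M (x 1)
      - 2 * (2 * x 1 ^ 2 + a ^ 2 * Real.cos (x 2) ^ 2) * deriv M (x 1)
      + x 1 * (x 1 ^ 2 - a ^ 2 * Real.cos (x 2) ^ 2) * deriv (deriv M) (x 1) := by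
  simp [psiNum, rhoC, rhoBar, -Complex.ofReal_cos, pow_two]
  ring

theorem psiNum_im (a : ℝ) (M : ℝ → ℝ) (x : Pt) :
    (psiNum a M x).im = 2 * (a * Real.cos (x 2)) * (3 * M (x 1) + x 1 * deriv M (x 1)
      - x 1 ^ 2 * deriv (deriv M) (x 1)) := by
  simp [psiNum, rhoC, rhoBar, -Complex.ofReal_cos, pow_two]
  ring

/-- If the numerator of `Ψ₂` vanishes at two points with the same `r ≠ 0` and different `cos² θ`,
then `M(r) = 0`. -/
theorem mass_eq_zero_of_psiNum (ha : a ≠ 0) {x y : Pt} (hxy : x 1 = y 1) (hr : y 1 ≠ 0)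
    (hc : Real.cos (x 2) ^ 2 ≠ Real.cos (y 2) ^ 2) (hx : psiNum a M x = 0)
    (hy : psiNum a M y = 0) : M (y 1) = 0 := by
  have rx := psiNum_re a M x
  have ry := psiNum_re a M y
  have ix := psiNum_im a M x
  have iy := psiNum_im a M y
  rw [hx, hxy] at rx ix
  rw [hy] at ry iy
  simp only [Complex.zero_re, Complex.zero_im] at rx ry ix iy
  set r := y 1
  set m := M r
  set m₁ := deriv M r
  set m₂ := deriv (deriv M) r
  set u := Real.cos (x 2)
  set v := Real.cos (y 2)
  -- The real part of the numerator is affine in cos²θ with slope -a²(2M' + rM''); two distinct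
  -- values of cos²θ make the slope and then the constant term vanish.
  have hB : 2 * m₁ + r * m₂ = 0 := by
    have : a ^ 2 * (u ^ 2 - v ^ 2) * (2 * m₁ + r * m₂) = 0 := by linear_combination rx - ry
    simpa [ha, sub_ne_zero.mpr hc] using this
  have hA : 6 * m - 4 * r * m₁ + r ^ 2 * m₂ = 0 := by
    have : r * (6 * m - 4 * r * m₁ + r ^ 2 * m₂) = 0 := by
      linear_combination -rx + a ^ 2 * u ^ 2 * hB
    simpa [hr] using this
  -- The imaginary part has the factor cos θ, which is nonzero at one of the two points since their
  -- values of cos²θ differ.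
  have hE : 3 * m + r * m₁ - r ^ 2 * m₂ = 0 := by
    by_cases hu : u = 0
    · have hv : v ≠ 0 := fun hv => hc (by rw [hu, hv])
      simpa [ha, hv] using iy.symm
    · simpa [ha, hu] using ix.symm
  -- These weights cancel M' and M'' and leave M with coefficient 1.
  linear_combination (1 / 12) * hA + (1 / 6) * hE + (1 / 12) * r * hB

/-- Otherwise the numerator vanishes on a neighbourhood inside M ≠ 0. Moving first r away from 0 and
then θ inside it produces two points at which `mass_eq_zero_of_psiNum` forces M(r) = 0. -/
theorem mass_ne_zero_subset_closure (ha : a ≠ 0) (hI : IsOpen I) (hM : ContDiffOn ℝ 3 M I) :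
    {x ∈ domain a M I | M (x 1) ≠ 0} ⊆ closure {x ∈ domain a M I | kerrPsi2 a M x ≠ 0} := by
  rintro x ⟨hx, hMx⟩
  rw [mem_closure_iff]
  intro V hV hxV
  by_contra hempty
  have hMc : ContinuousOn (fun y : Pt => M (y 1)) (domain a M I) :=
    hM.continuousOn.comp (continuous_apply 1).continuousOn fun y hy => hy.1
  set W : Set Pt := V ∩ (domain a M I ∩ (fun y : Pt => M (y 1)) ⁻¹' {0}ᶜ) with hWdef
  have hW : IsOpen W :=
    hV.inter (hMc.isOpen_inter_preimage (isOpen_domain a hI hM) isOpen_compl_singleton)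
  have hzero : ∀ y ∈ W, psiNum a M y = 0 := by
    intro y hy
    by_contra h
    exact hempty ⟨y, hy.1, hy.2.1, fun h0 => h ((kerrPsi2_eq_zero_iff hI hM hy.2.1).mp h0)⟩
  have hopen : ∀ (i : Fin 4) (y : Pt), IsOpen {s : ℝ | Function.update y i s ∈ W} := fun i y =>
    hW.preimage (by fun_prop)
  -- The point itself may have r = 0, where the linear system is degenerate, so r is moved within
  -- the open set.
  obtain ⟨r, hrW, hr0⟩ := (dense_compl_singleton (0 : ℝ)).inter_open_nonempty _ (hopen 1 x)
    ⟨x 1, by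
      rw [Set.mem_ofPred_eq, Function.update_eq_self]
      exact ⟨hxV, hx, hMx⟩⟩
  set y := Function.update x 1 r with hy
  have hyr : y 1 = r := by simp [hy]
  obtain ⟨ε, hε, hball⟩ := Metric.isOpen_iff.mp (hopen 2 y) (y 2) (by
    rw [Set.mem_ofPred_eq, Function.update_eq_self]
    exact hrW)
  have hmem : ∀ δ, 0 ≤ δ → δ < ε → Function.update y 2 (y 2 + δ) ∈ W := fun δ h0 h1 =>
    hball (by simpa [Real.dist_eq, abs_of_nonneg h0] using h1)
  have hMr : M r ≠ 0 := by
    have := hrW.2.2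
    simpa [hyr] using this
  have key : ∀ δ δ', 0 ≤ δ → δ < ε → 0 ≤ δ' → δ' < ε →
      Real.cos (y 2 + δ) ^ 2 = Real.cos (y 2 + δ') ^ 2 := by
    intro δ δ' h0 h1 h0' h1'
    by_contra hne
    refine hMr ?_
    have := mass_eq_zero_of_psiNum (M := M) ha (x := Function.update y 2 (y 2 + δ))
      (y := Function.update y 2 (y 2 + δ')) (by simp) (by simpa [hyr] using hr0)
      (by simpa using hne) (hzero _ (hmem δ h0 h1)) (hzero _ (hmem δ' h0' h1'))
    simpa [hyr] using this
  have hinj : ∀ δ δ', 0 ≤ δ → δ < ε → 0 ≤ δ' → δ' < ε → δ ≠ δ' →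
      Real.cos (y 2 + δ) ≠ Real.cos (y 2 + δ') := by
    intro δ δ' h0 h1 h0' h1' hne hcos
    have m1 := (hmem δ h0 h1).2.1.2.1
    have m2 := (hmem δ' h0' h1').2.1.2.1
    simp only [Function.update_self] at m1 m2
    have := Real.injOn_cos (Set.Ioo_subset_Icc_self m1) (Set.Ioo_subset_Icc_self m2) hcos
    exact hne (by linarith)
  -- On (0, π) cos is injective but cos² takes values twice, so three angles are used: with equal
  -- cos² and distinct cosines, the second and third cosines would both be the negative of the first
  -- and hence equal.
  have k1 := key 0 (ε / 2) le_rfl hε (by linarith) (by linarith)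
  have k2 := key 0 (ε / 3) le_rfl hε (by linarith) (by linarith)
  have i1 := hinj 0 (ε / 2) le_rfl hε (by linarith) (by linarith) (by linarith)
  have i2 := hinj 0 (ε / 3) le_rfl hε (by linarith) (by linarith) (by linarith)
  have i3 := hinj (ε / 2) (ε / 3) (by linarith) (by linarith) (by linarith) (by linarith)
    (by linarith)
  rcases sq_eq_sq_iff_eq_or_eq_neg.mp k1 with h | h
  · exact i1 h
  rcases sq_eq_sq_iff_eq_or_eq_neg.mp k2 with h' | h'
  · exact i2 h'
  exact i3 (by linarith)

end topology

end KerrLike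

end

theorem proposition1 (a : ℝ) (ha : a ≠ 0) (I : Set ℝ) (hI : IsOpen I)
    (M : ℝ → ℝ) (hM : ContDiffOn ℝ 3 M I) :
    (∀ x ∈ KerrLike.domain a M I,
      KerrLike.IsNullTetrad (KerrLike.metric a M x)
        (KerrLike.vecL a M x) (KerrLike.vecK a M x) (KerrLike.vecM a x) ∧
      KerrLike.Psi0 (KerrLike.weyl (KerrLike.metric a M) x)
        (KerrLike.vecL a M x) (KerrLike.vecM a x) = 0 ∧
      KerrLike.Psi1 (KerrLike.weyl (KerrLike.metric a M) x)
        (KerrLike.vecL a M x) (KerrLike.vecK a M x) (KerrLike.vecM a x) = 0 ∧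
      KerrLike.Psi3 (KerrLike.weyl (KerrLike.metric a M) x)
        (KerrLike.vecL a M x) (KerrLike.vecK a M x) (KerrLike.vecM a x) = 0 ∧
      KerrLike.Psi4 (KerrLike.weyl (KerrLike.metric a M) x)
        (KerrLike.vecK a M x) (KerrLike.vecM a x) = 0 ∧
      KerrLike.kerrPsi2 a M x =
        -((6 * KerrLike.rhoC a x * (M (x 1) : ℂ)
            - 2 * ((x 1 : ℂ) + KerrLike.rhoC a x) * KerrLike.rhoBar a x * ((deriv M (x 1) : ℝ) : ℂ)
            + (x 1 : ℂ) * KerrLike.rhoBar a x ^ 2 * ((deriv (deriv M) (x 1) : ℝ) : ℂ))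
          / (6 * KerrLike.rhoC a x * KerrLike.rhoBar a x ^ 3)) ∧
      (KerrLike.kerrPsi2 a M x ≠ 0 →
        KerrLike.HasDoublePNDPair (KerrLike.metric a M x) (KerrLike.weyl (KerrLike.metric a M) x)
          (KerrLike.vecL a M x) (KerrLike.vecK a M x)) ∧
      (KerrLike.IsPetrovTypeD (KerrLike.metric a M x) (KerrLike.weyl (KerrLike.metric a M) x) ↔
        KerrLike.kerrPsi2 a M x ≠ 0)) ∧
    IsOpen {x ∈ KerrLike.domain a M I | KerrLike.kerrPsi2 a M x ≠ 0} ∧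
    {x ∈ KerrLike.domain a M I | M (x 1) ≠ 0} ⊆
      closure {x ∈ KerrLike.domain a M I | KerrLike.kerrPsi2 a M x ≠ 0} := by
  refine ⟨fun x hx => ?_, KerrLike.isOpen_kerrPsi2_ne_zero hI hM,
    KerrLike.mass_ne_zero_subset_closure ha hI hM⟩
  have hT := KerrLike.adaptedTetrad_kerr hx
  have hW := KerrLike.weyl_metric hI hM hx
  have hψ := KerrLike.kerrPsi2_eq hI hM hx
  obtain ⟨h0, h1, h3, h4, -⟩ := hT.scalars
    (p := KerrLike.psiRe a (KerrLike.massN M) (KerrLike.massN' M) (KerrLike.massN'' M) (x 1) (x 2))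
    (q := KerrLike.psiIm a (KerrLike.massN M) (KerrLike.massN' M) (x 1) (x 2))
  have hpair : KerrLike.kerrPsi2 a M x ≠ 0 →
      KerrLike.HasDoublePNDPair (KerrLike.metric a M x) (KerrLike.weyl (KerrLike.metric a M) x)
        (KerrLike.vecL a M x) (KerrLike.vecK a M x) := fun h => by
    rw [hW]
    exact hT.hasDoublePNDPair (hψ ▸ h)
  refine ⟨hT.products, ?_, ?_, ?_, ?_, KerrLike.kerrPsi2_formula hI hM hx, hpair,
    fun h => ?_, fun h => ⟨_, _, hpair h⟩⟩
  · rw [hW]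
    exact h0
  · rw [hW]
    exact h1
  · rw [hW]
    exact h3
  · rw [hW]
    exact h4
  · rw [hW] at h
    rw [hψ]
    exact h.typeDTensor_ne_zero
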